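/- Let $n\in\mathbb N$, $\hbar>0$, $t\in\mathbb R\setminus\{0\}$ and $q_1,\dots,q_n>0$, and let $g_n\in\mathcal S(\mathbb R^n)$ be the Gaussian window $$g_n(x)=(2\pi\hbar)^{-n/2}\,e^{-\frac1{2\hbar}\sum_{j=1}^n q_jx_j^2}.$$ For $f\in\mathcal S'(\mathbb R^n)$ and $x,\xi\in\mathbb R^n$ put $$V_{g_n}f(x,\xi)=\langle f,\pi(x,\xi)g_n\rangle,\qquad \pi(x,\xi)g_n(y)=(2\pi\hbar)^{-n/2}e^{\frac i\hbar\xi\cdot y}g_n(y-x),$$ where $\langle f,\varphi\rangle=f(\overline\varphi)$, and $$\|f\|_{M^{\infty,1}_{(g_n)}(\mathbb R^n)}=\int_{\mathbb R^n}\sup_{x\in\mathbb R^n}|V_{g_n}f(x,\xi)|\,d\xi .$$ Let $M^{\infty,1}(\mathbb R^n)$ be the space of all $f\in\mathcal S'(\mathbb R^n)$ for which this norm is finite. Let $e^{\frac{i\hbar t}2\Delta}:\mathcal S'(\mathbb R^n)\to\mathcal S'(\mathbb R^n)$ be the free Schrödinger propagator, i.e. the Fourier multiplier operator that maps $u(0,\cdot)=f$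 to the solution $u(t,\cdot)$ of $i\hbar\,\partial_tu=-\frac{\hbar^2}2\Delta u$. For $u\in\mathcal S'(\mathbb R^n)$, set $\|u\|_{L^\infty}=\infty$ if $u$ is not given by an $L^\infty$ function. Then $$\sup_{f\in M^{\infty,1}(\mathbb R^n)\setminus\{0\}}\frac{\|e^{\frac{i\hbar t}2\Delta}f\|_{L^\infty(\mathbb R^n)}}{\|f\|_{M^{\infty,1}_{(g_n)}(\mathbb R^n)}}=\prod_{j=1}^n(t^2q_j^2+1)^{1/4}.$$ -/

import Mathlib

open MeasureTheory
open scoped SchwartzMap ENNReal InnerProductSpace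

noncomputable section

namespace Sjostrand

/-- Euclidean space `ℝⁿ`. -/
abbrev Rn (n : ℕ) := EuclideanSpace ℝ (Fin n)

/-! ### Temperate growth of unimodular exponentials -/

theorem iteratedDeriv_cexp_I (k : ℕ) :
    iteratedDeriv k (fun s : ℝ => Complex.exp (Complex.I * s)) =
      fun s : ℝ => Complex.I ^ k * Complex.exp (Complex.I * s) := by
  induction k with
  | zero => simp
  | succ k ih =>
    rw [iteratedDeriv_succ, ih]
    funext s
    have h1 : HasDerivAt (fun s : ℝ => Complex.I * (s : ℂ)) (Complex.I * 1) s :=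
      (Complex.ofRealCLM.hasDerivAt (x := s)).const_mul Complex.I
    have h2 := (h1.cexp).const_mul (Complex.I ^ k)
    rw [h2.deriv]
    ring

theorem hasTemperateGrowth_cexp_I :
    (fun s : ℝ => Complex.exp (Complex.I * s)).HasTemperateGrowth := by
  refine ⟨(contDiff_const.mul Complex.ofRealCLM.contDiff).cexp, fun k => ⟨0, 1, fun s => ?_⟩⟩
  rw [norm_iteratedFDeriv_eq_norm_iteratedDeriv, iteratedDeriv_cexp_I]
  simp [Complex.norm_exp]

theorem hasTemperateGrowth_cexp_I_comp {E : Type*} [NormedAddCommGroup E] [NormedSpace ℝ E]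
    {p : E → ℝ} (hp : p.HasTemperateGrowth) :
    (fun x => Complex.exp (Complex.I * (p x : ℝ))).HasTemperateGrowth :=
  hasTemperateGrowth_cexp_I.comp hp

/-! ### Phase space shifts and the Gabor transform -/

/-- The multiplier `y ↦ (2πħ)^{-n/2} e^{(i/ħ) ξ·y}`. -/
def modulation {n : ℕ} (ħ : ℝ) (ξ : Rn n) (y : Rn n) : ℂ :=
  (((2 * Real.pi * ħ) ^ (-(n : ℝ) / 2) : ℝ) : ℂ) *
    Complex.exp (Complex.I * ((ħ⁻¹ * ⟪ξ, y⟫_ℝ : ℝ) : ℂ))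

theorem modulation_hasTemperateGrowth {n : ℕ} (ħ : ℝ) (ξ : Rn n) :
    (modulation ħ ξ).HasTemperateGrowth := by
  have h : (fun y : Rn n => ħ⁻¹ * ⟪ξ, y⟫_ℝ).HasTemperateGrowth := by fun_prop
  exact (Function.HasTemperateGrowth.const _).mul (hasTemperateGrowth_cexp_I_comp h)

/-- The phase space shift `π(x,ξ) g (y) = (2πħ)^{-n/2} e^{(i/ħ) ξ·y} g(y - x)`. -/
def phaseShift {n : ℕ} (ħ : ℝ) (x ξ : Rn n) (g : 𝓢(Rn n, ℂ)) : 𝓢(Rn n, ℂ) :=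
  SchwartzMap.smulLeftCLM ℂ (modulation ħ ξ) (SchwartzMap.compSubConstCLM ℂ x g)

theorem phaseShift_apply {n : ℕ} (ħ : ℝ) (x ξ : Rn n) (g : 𝓢(Rn n, ℂ)) (y : Rn n) :
    phaseShift ħ x ξ g y = modulation ħ ξ y * g (y - x) := by
  simp [phaseShift, SchwartzMap.smulLeftCLM_apply_apply (modulation_hasTemperateGrowth ħ ξ)]

/-- Pointwise complex conjugation of a Schwartz function. -/
def conj {n : ℕ} (g : 𝓢(Rn n, ℂ)) : 𝓢(Rn n, ℂ) :=
  SchwartzMap.postcompCLM (Complex.conjCLE : ℂ →L[ℝ] ℂ) g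

theorem conj_apply {n : ℕ} (g : 𝓢(Rn n, ℂ)) (y : Rn n) :
    conj g y = (starRingEnd ℂ) (g y) := rfl

/-- The Gabor (short-time Fourier) transform `V_g f (x,ξ) = ⟨f, π(x,ξ) g⟩` of a tempered
distribution `f`, where the pairing `⟨f, φ⟩ = f (conj φ)` is antilinear in `φ`. -/
def gabor {n : ℕ} (ħ : ℝ) (g : 𝓢(Rn n, ℂ)) (f : 𝓢'(Rn n, ℂ)) (x ξ : Rn n) : ℂ :=
  f (conj (phaseShift ħ x ξ g))

/-- On a distribution given by a Schwartz function, the Gabor transform is the usual integral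
`(2πħ)^{-n/2} ∫ e^{-(i/ħ) ξ·y} f(y) conj(g(y-x)) dy`. -/
theorem gabor_schwartz {n : ℕ} (ħ : ℝ) (g f : 𝓢(Rn n, ℂ)) (x ξ : Rn n) :
    gabor ħ g (f : 𝓢'(Rn n, ℂ)) x ξ =
      ∫ y, (starRingEnd ℂ) (modulation ħ ξ y) * (f y * (starRingEnd ℂ) (g (y - x))) := by
  rw [gabor, SchwartzMap.coe_apply]
  congr 1
  funext y
  rw [conj_apply, phaseShift_apply, map_mul, smul_eq_mul]
  ring

/-- The norm `∫ sup_x |V_g f (x,ξ)| dξ`, with values in `[0,∞]`. -/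
def sjostrandNorm {n : ℕ} (ħ : ℝ) (g : 𝓢(Rn n, ℂ)) (f : 𝓢'(Rn n, ℂ)) : ℝ≥0∞ :=
  ∫⁻ ξ : Rn n, ⨆ x : Rn n, ‖gabor ħ g f x ξ‖ₑ

/-- The Sjöstrand class `M^{∞,1}(ℝⁿ)`: the tempered distributions of finite norm, for the given
window `g`. -/
def sjostrandClass {n : ℕ} (ħ : ℝ) (g : 𝓢(Rn n, ℂ)) : Set 𝓢'(Rn n, ℂ) :=
  {f | sjostrandNorm ħ g f < ∞}

/-! ### The Gaussian window -/

/-- The exponent `-(1/2ħ) ⟨x, Qx⟩` with `Q = diag(q₁, …, qₙ)`. -/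
def gaussExponent {n : ℕ} (ħ : ℝ) (q : Fin n → ℝ) (x : Rn n) : ℝ :=
  -(2 * ħ)⁻¹ * ∑ j, q j * x j ^ 2

theorem gaussExponent_hasTemperateGrowth {n : ℕ} (ħ : ℝ) (q : Fin n → ℝ) :
    (gaussExponent ħ q).HasTemperateGrowth := by
  have hx (j : Fin n) : (fun x : Rn n => x j).HasTemperateGrowth :=
    (EuclideanSpace.proj j : Rn n →L[ℝ] ℝ).hasTemperateGrowth
  have hs : (fun x : Rn n => ∑ j, q j * x j ^ 2).HasTemperateGrowth :=
    Function.HasTemperateGrowth.sum fun j _ =>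
      (Function.HasTemperateGrowth.const (q j)).mul ((hx j).pow 2)
  exact (Function.HasTemperateGrowth.const _).mul hs

theorem gaussExponent_le {n : ℕ} {ħ : ℝ} (hħ : 0 < ħ) {q : Fin n → ℝ} (hq : ∀ j, 0 < q j) :
    ∃ c : ℝ, 0 < c ∧ ∀ x : Rn n, gaussExponent ħ q x ≤ -c * ‖x‖ ^ 2 := by
  obtain ⟨m, hm, hmq⟩ : ∃ m : ℝ, 0 < m ∧ ∀ j, m ≤ q j := by
    rcases isEmpty_or_nonempty (Fin n) with h | h
    · exact ⟨1, one_pos, fun j => (h.false j).elim⟩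
    · obtain ⟨j, hj⟩ := Finite.exists_min q
      exact ⟨q j, hq j, hj⟩
  refine ⟨(2 * ħ)⁻¹ * m, by positivity, fun x => ?_⟩
  rw [EuclideanSpace.real_norm_sq_eq, gaussExponent, neg_mul, neg_mul, neg_le_neg_iff, mul_assoc,
    Finset.mul_sum]
  gcongr with j
  exact hmq j

theorem one_add_pow_mul_exp_bounded {c : ℝ} (hc : 0 < c) (N : ℕ) :
    ∃ B : ℝ, ∀ r : ℝ, 0 ≤ r → (1 + r) ^ N * Real.exp (-c * r ^ 2) ≤ B := by
  obtain ⟨d, hd, hd1⟩ : ∃ d : ℝ, 0 < d ∧ d * (N + 1) ≤ c := ⟨c / (N + 1), by positivity, by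
    field_simp; exact le_refl _⟩
  refine ⟨(Real.exp (d⁻¹ + 2)) ^ N, fun r hr => ?_⟩
  have h1 : (1 + r) * Real.exp (-d * r ^ 2) ≤ Real.exp (d⁻¹ + 2) := by
    have h2 : 1 + r ≤ Real.exp r := by linarith [Real.add_one_le_exp r]
    calc _ ≤ Real.exp r * Real.exp (-d * r ^ 2) := by gcongr
      _ = Real.exp (r - d * r ^ 2) := by rw [← Real.exp_add]; ring_nf
      _ ≤ _ := by
        apply Real.exp_le_exp.mpr
        have h3 : d * d⁻¹ = 1 := mul_inv_cancel₀ hd.ne'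
        have h4 : 0 < d⁻¹ := by positivity
        have h5 : 0 ≤ d * (r - d⁻¹) ^ 2 := by positivity
        have h6 : d * (r - d⁻¹) ^ 2 = d * r ^ 2 - 2 * r + d⁻¹ := by
          linear_combination (-2 * r + d⁻¹) * h3
        nlinarith
  calc (1 + r) ^ N * Real.exp (-c * r ^ 2)
      ≤ (1 + r) ^ N * Real.exp (N * (-d * r ^ 2)) := by
        refine mul_le_mul_of_nonneg_left (Real.exp_le_exp.mpr ?_) (by positivity)
        nlinarith [mul_nonneg hd.le (sq_nonneg r), mul_le_mul_of_nonneg_right hd1 (sq_nonneg r)]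
    _ = ((1 + r) * Real.exp (-d * r ^ 2)) ^ N := by rw [mul_pow, ← Real.exp_nat_mul]
    _ ≤ _ := by gcongr

theorem gaussian_decay {n : ℕ} {ħ : ℝ} (hħ : 0 < ħ) {q : Fin n → ℝ} (hq : ∀ j, 0 < q j)
    (k m : ℕ) : ∃ C : ℝ, ∀ x : Rn n,
      ‖x‖ ^ k * ‖iteratedFDeriv ℝ m (fun x => Real.exp (gaussExponent ħ q x)) x‖ ≤ C := by
  have hp := gaussExponent_hasTemperateGrowth ħ q
  obtain ⟨c, hc, hle⟩ := gaussExponent_le hħ hq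
  obtain ⟨l, D, hD0, hD⟩ := hp.norm_iteratedFDeriv_le_uniform m
  obtain ⟨B, hB⟩ := one_add_pow_mul_exp_bounded hc (k + l * m)
  refine ⟨m.factorial * (D + 1) ^ m * B, fun x => ?_⟩
  have h1 : ‖iteratedFDeriv ℝ m (Real.exp ∘ gaussExponent ħ q) x‖ ≤
      m.factorial * Real.exp (gaussExponent ħ q x) * ((D + 1) * (1 + ‖x‖) ^ l) ^ m := by
    refine norm_iteratedFDeriv_comp_le (N := ((m : ℕ∞) : WithTop ℕ∞)) Real.contDiff_exp
      (hp.1.of_le (mod_cast le_top)) le_rfl x (fun i _ => ?_) (fun i hi him => ?_)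
    · rw [norm_iteratedFDeriv_eq_norm_iteratedDeriv, iteratedDeriv_eq_iterate,
        Real.iter_deriv_exp, Real.norm_of_nonneg (Real.exp_pos _).le]
    · have hone : 1 ≤ (1 + ‖x‖) ^ l := one_le_pow₀ (by linarith [norm_nonneg x])
      have hone' : 1 ≤ (D + 1) * (1 + ‖x‖) ^ l := by nlinarith
      calc _ ≤ D * (1 + ‖x‖) ^ l := hD i him x
        _ ≤ (D + 1) * (1 + ‖x‖) ^ l := by gcongr; linarith
        _ ≤ _ := le_self_pow₀ hone' (by omega)
  have h2 : ‖x‖ ^ k ≤ (1 + ‖x‖) ^ k := by gcongr; linarith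
  calc _ ≤ (1 + ‖x‖) ^ k *
        (m.factorial * Real.exp (-c * ‖x‖ ^ 2) * ((D + 1) * (1 + ‖x‖) ^ l) ^ m) := by
        refine mul_le_mul h2 (h1.trans ?_) (norm_nonneg _) (by positivity)
        gcongr
        exact hle x
    _ = m.factorial * (D + 1) ^ m * ((1 + ‖x‖) ^ (k + l * m) * Real.exp (-c * ‖x‖ ^ 2)) := by
        rw [mul_pow, ← pow_mul, pow_add]; ring
    _ ≤ _ := by
        gcongr
        exact hB _ (norm_nonneg x)

/-- The Gaussian window `gₙ(x) = (2πħ)^{-n/2} e^{-(1/2ħ) ⟨x, Qx⟩}`, `Q = diag(q₁, …, qₙ)`, as a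
Schwartz function. -/
def gaussianWindow {n : ℕ} {ħ : ℝ} (hħ : 0 < ħ) {q : Fin n → ℝ} (hq : ∀ j, 0 < q j) :
    𝓢(Rn n, ℂ) :=
  ((2 * Real.pi * ħ) ^ (-(n : ℝ) / 2) : ℝ) • SchwartzMap.postcompCLM Complex.ofRealCLM
    { toFun := fun x => Real.exp (gaussExponent ħ q x)
      smooth' := Real.contDiff_exp.comp (gaussExponent_hasTemperateGrowth ħ q).1
      decay' := gaussian_decay hħ hq }

theorem gaussianWindow_apply {n : ℕ} {ħ : ℝ} (hħ : 0 < ħ) {q : Fin n → ℝ} (hq : ∀ j, 0 < q j)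
    (x : Rn n) : gaussianWindow hħ hq x =
      (((2 * Real.pi * ħ) ^ (-(n : ℝ) / 2) *
        Real.exp (-(2 * ħ)⁻¹ * ∑ j, q j * x j ^ 2) : ℝ) : ℂ) := by
  rw [Complex.ofReal_mul, ← Complex.real_smul]
  rfl

/-! ### The free Schrödinger propagator -/

/-- The symbol of `e^{iħtΔ/2}`. Mathlib's Fourier transform has the kernel `e^{-2πi x·ξ}`, so `Δ` is
the Fourier multiplier with symbol `-4π²|ξ|²`, and `e^{iħtΔ/2}` the one with symbol
`e^{-2π²iħt|ξ|²}`. -/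
def schrodingerSymbol {n : ℕ} (ħ t : ℝ) (ξ : Rn n) : ℂ :=
  Complex.exp (Complex.I * ((ħ * t / 2 * (-(2 * Real.pi) ^ 2 * ‖ξ‖ ^ 2) : ℝ) : ℂ))

theorem schrodingerSymbol_hasTemperateGrowth {n : ℕ} (ħ t : ℝ) :
    (schrodingerSymbol ħ t : Rn n → ℂ).HasTemperateGrowth := by
  have h : (fun ξ : Rn n => ħ * t / 2 * (-(2 * Real.pi) ^ 2 * ‖ξ‖ ^ 2)).HasTemperateGrowth :=
    (Function.HasTemperateGrowth.const _).mul ((Function.HasTemperateGrowth.const _).mul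
      (Function.hasTemperateGrowth_norm_sq (Rn n)))
  exact hasTemperateGrowth_cexp_I_comp h

/-- The free Schrödinger propagator `e^{iħtΔ/2}` on tempered distributions, i.e. the solution
operator `u(0,·) ↦ u(t,·)` of `iħ ∂ₜu = -(ħ²/2) Δu`. -/
def schrodingerPropagator (n : ℕ) (ħ t : ℝ) : 𝓢'(Rn n, ℂ) →L[ℂ] 𝓢'(Rn n, ℂ) :=
  TemperedDistribution.fourierMultiplierCLM ℂ (schrodingerSymbol ħ t)

/-- The `L^∞(ℝⁿ)` norm of a tempered distribution; it is `∞` if `u` is not given by an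
`L^∞` function. -/
def lInftyNorm {n : ℕ} (u : 𝓢'(Rn n, ℂ)) : ℝ≥0∞ :=
  ⨅ (h : Lp ℂ ∞ (volume : Measure (Rn n))) (_ : (h : 𝓢'(Rn n, ℂ)) = u), ‖h‖ₑ

end Sjostrand

end

noncomputable section

namespace Sjostrand

/-! Upper bound. Write `T_y` for translation, `M_η` for multiplication by `e^{2πi⟨η,y⟩}`. A tempered
distribution `u` satisfies the inversion formula `γ(0) u(y) = ∫ u(T_y M_η γ) dη` in the weak sense,
so a finite integral of `sup_y |u(T_y M_η γ)|` bounds `‖u‖_∞`, with constant `1/|γ(0)|`. Take `u` to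
be the propagated `f`. The dual propagator moves a phase space shift of `γ` to the shift of its
evolution along the classical flow, up to a unimodular factor, and this displacement is invisible to
a supremum over positions. If `γ` is the window evolved by `-t`, the bound is therefore the
Sjöstrand norm of `f` up to powers of `2πħ`. The constant comes from the value of the evolved
Gaussian at the origin, whose modulus is that of the window's prefactor times `∏ (1 +
t²q_j²)^{-1/4}`. The carrying lemmas are `integral_integral_apply_modulateCLM`,
`dualPropagator_compSubConstCLM_modulateCLM` and `norm_dualPropagator_gaussianWindow`.

Lower bound. Wide Gaussians `e^{-ε|y|²/(2ħ)}` with the phase `e^{-i|y|²/(2ħt)}` focus at the origin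
at time `t`. Both their height there and their norm are controlled by explicit Gaussian integrals,
and the resulting lower bounds for the quotient tend to the same constant as `ε → 0`
(`prod_chirpRatio_le`, `tendsto_chirpRatio`). -/

theorem integral_mem_of_isClosed {Z G : Type*} [MeasurableSpace Z] [TopologicalSpace Z]
    [OpensMeasurableSpace Z] [SecondCountableTopology Z] {μ : Measure Z}
    [NormedAddCommGroup G] [NormedSpace ℝ G] [CompleteSpace G] (K : Submodule ℝ G)
    (hK : IsClosed (K : Set G)) {F : Z → G} (hF : Continuous F) (hi : Integrable F μ)
    (hm : ∀ z, F z ∈ K) : ∫ z, F z ∂μ ∈ K := by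
  -- A closed subspace of a Banach space is Banach, so the integral can be formed inside `K` and
  -- then included.
  have : CompleteSpace K := hK.completeSpace_coe
  have hc : Continuous (fun z => (⟨F z, hm z⟩ : K)) := hF.subtype_mk hm
  have hi' : Integrable (fun z => (⟨F z, hm z⟩ : K)) μ :=
    ⟨hc.aestronglyMeasurable, hi.2⟩
  have h := K.subtypeL.integral_comp_comm hi'
  have h2 : ∫ z, F z ∂μ = K.subtypeL (∫ z, (⟨F z, hm z⟩ : K) ∂μ) := by
    rw [← h]; rfl
  rw [h2]
  exact Subtype.mem _

/-! ### Tempered distributions commute with integrals of Schwartz functions -/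

section Interchange

variable {E : Type*} [NormedAddCommGroup E] [NormedSpace ℝ E]

variable (E) in
/-- The normed space of `l`-linear forms on `E`, the values of `l`-th derivatives. -/
def DerivSpace (l : ℕ) : Type _ := E [×l]→L[ℝ] ℂ

instance (l : ℕ) : NormedAddCommGroup (DerivSpace E l) :=
  inferInstanceAs (NormedAddCommGroup (E [×l]→L[ℝ] ℂ))

instance (l : ℕ) : NormedSpace ℝ (DerivSpace E l) :=
  inferInstanceAs (NormedSpace ℝ (E [×l]→L[ℝ] ℂ))

instance (l : ℕ) : CompleteSpace (DerivSpace E l) :=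
  inferInstanceAs (CompleteSpace (E [×l]→L[ℝ] ℂ))

/-- The `l`-th derivative of a Schwartz function, with values in `DerivSpace`. -/
def schwartzDeriv (l : ℕ) (φ : 𝓢(E, ℂ)) (x : E) : DerivSpace E l := iteratedFDeriv ℝ l φ x

theorem continuous_schwartzDeriv (l : ℕ) (φ : 𝓢(E, ℂ)) : Continuous (schwartzDeriv l φ) :=
  (φ.smooth ⊤).continuous_iteratedFDeriv (mod_cast le_top)

theorem le_seminorm_schwartzDeriv (k l : ℕ) (φ : 𝓢(E, ℂ)) (x : E) :
    ‖x‖ ^ k * ‖schwartzDeriv l φ x‖ ≤ SchwartzMap.seminorm ℝ k l φ :=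
  SchwartzMap.le_seminorm ℝ k l φ x

theorem schwartzDeriv_add (l : ℕ) (φ ψ : 𝓢(E, ℂ)) (x : E) :
    schwartzDeriv l (φ + ψ) x = schwartzDeriv l φ x + schwartzDeriv l ψ x :=
  iteratedFDeriv_add_apply ((φ.smooth l).contDiffAt) ((ψ.smooth l).contDiffAt)

theorem schwartzDeriv_smul (l : ℕ) (a : ℝ) (φ : 𝓢(E, ℂ)) (x : E) :
    schwartzDeriv l (a • φ) x = a • schwartzDeriv l φ x :=
  iteratedFDeriv_const_smul_apply ((φ.smooth l).contDiffAt)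

/-- The bounded continuous function `x ↦ ‖x‖ ^ k • D^l φ x`, as a function of `φ`. -/
def weightedDerivCLM (k l : ℕ) : 𝓢(E, ℂ) →L[ℝ] BoundedContinuousFunction E (DerivSpace E l) :=
  SchwartzMap.mkCLMtoNormedSpace (σ := RingHom.id ℝ)
    (fun φ => BoundedContinuousFunction.ofNormedAddCommGroup
      (fun x => ‖x‖ ^ k • schwartzDeriv l φ x)
      ((continuous_norm.pow k).smul (continuous_schwartzDeriv l φ))
      (SchwartzMap.seminorm ℝ k l φ)
      (fun x => by
        rw [norm_smul, norm_pow, norm_norm]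
        exact le_seminorm_schwartzDeriv k l φ x))
    (fun φ ψ => by
      ext1 x
      change ‖x‖ ^ k • schwartzDeriv l (φ + ψ) x = _
      rw [schwartzDeriv_add, smul_add]
      rfl)
    (fun a φ => by
      ext1 x
      change ‖x‖ ^ k • schwartzDeriv l (a • φ) x = _
      rw [schwartzDeriv_smul, smul_comm]
      rfl)
    ⟨{(k, l)}, 1, zero_le_one, fun φ => by
      rw [one_mul, Finset.sup_singleton]
      exact BoundedContinuousFunction.norm_ofNormedAddCommGroup_le _ (apply_nonneg _ _) _⟩

@[simp]
theorem weightedDerivCLM_apply (k l : ℕ) (φ : 𝓢(E, ℂ)) (x : E) :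
    weightedDerivCLM k l φ x = ‖x‖ ^ k • schwartzDeriv l φ x := rfl

theorem norm_weightedDerivCLM_le (k l : ℕ) (φ : 𝓢(E, ℂ)) :
    ‖weightedDerivCLM k l φ‖ ≤ SchwartzMap.seminorm ℂ k l φ :=
  BoundedContinuousFunction.norm_ofNormedAddCommGroup_le
    ((continuous_norm.pow k).smul (continuous_schwartzDeriv l φ)) (apply_nonneg _ _) fun x => by
      change ‖‖x‖ ^ k • schwartzDeriv l φ x‖ ≤ _
      rw [norm_smul, norm_pow, norm_norm]
      exact le_seminorm_schwartzDeriv k l φ x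

theorem seminorm_le_norm_weightedDerivCLM (k l : ℕ) (φ : 𝓢(E, ℂ)) :
    SchwartzMap.seminorm ℂ k l φ ≤ ‖weightedDerivCLM k l φ‖ := by
  refine SchwartzMap.seminorm_le_bound ℂ k l φ (norm_nonneg _) fun x => ?_
  have h := (weightedDerivCLM k l φ).norm_coe_le_norm x
  rwa [weightedDerivCLM_apply, norm_smul, norm_pow, norm_norm] at h

theorem fderiv_integral_apply {Z G : Type*} [MeasurableSpace Z] {μ : Measure Z} [NormedAddCommGroup G] [NormedSpace ℝ G]
    {F : Z → E → G} {b : Z → ℝ} (hb : Integrable b μ) (hF : ∀ x, Integrable (fun z => F z x) μ)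
    (hF' : ∀ x, AEStronglyMeasurable (fun z => fderiv ℝ (F z) x) μ)
    (hFb : ∀ z x, ‖fderiv ℝ (F z) x‖ ≤ b z) (hd : ∀ z, Differentiable ℝ (F z)) (x v : E) :
    fderiv ℝ (fun x => ∫ z, F z x ∂μ) x v = ∫ z, fderiv ℝ (F z) x v ∂μ := by
  have h : HasFDerivAt (fun x => ∫ z, F z x ∂μ) (∫ z, fderiv ℝ (F z) x ∂μ) x :=
    hasFDerivAt_integral_of_dominated_of_fderiv_le (s := Set.univ) Filter.univ_mem
      (Filter.Eventually.of_forall fun y => (hF y).aestronglyMeasurable) (hF x) (hF' x)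
      (Filter.Eventually.of_forall fun z y _ => hFb z y) hb
      (Filter.Eventually.of_forall fun z y _ => (hd z y).hasFDerivAt)
  rw [h.fderiv, ContinuousLinearMap.integral_apply]
  exact hb.mono' (hF' x) (Filter.Eventually.of_forall fun z => hFb z x)

variable {Z : Type*} [MeasurableSpace Z] [TopologicalSpace Z]
  [OpensMeasurableSpace Z] [SecondCountableTopology Z] {μ : Measure Z}

theorem integrable_weightedDerivCLM {Ψ : Z → 𝓢(E, ℂ)} (hΨ : Continuous Ψ) (k l : ℕ)
    (hb : ∃ b : Z → ℝ, Integrable b μ ∧ ∀ z, SchwartzMap.seminorm ℂ k l (Ψ z) ≤ b z) :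
    Integrable (fun z => weightedDerivCLM k l (Ψ z)) μ := by
  obtain ⟨b, hb, hle⟩ := hb
  refine hb.mono' ((weightedDerivCLM k l).continuous.comp hΨ).aestronglyMeasurable
    (Filter.Eventually.of_forall fun z => (norm_weightedDerivCLM_le k l (Ψ z)).trans (hle z))

theorem integrable_iteratedFDeriv_apply {Ψ : Z → 𝓢(E, ℂ)} (hΨ : Continuous Ψ) (l : ℕ)
    (hb : ∃ b : Z → ℝ, Integrable b μ ∧ ∀ z, SchwartzMap.seminorm ℂ 0 l (Ψ z) ≤ b z) (x : E) :
    Integrable (fun z => iteratedFDeriv ℝ l (Ψ z) x) μ := by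
  have h := (BoundedContinuousFunction.evalCLM ℝ x).integrable_comp
    (integrable_weightedDerivCLM hΨ 0 l hb)
  have h2 : Integrable (fun z => schwartzDeriv l (Ψ z) x) μ := by simpa using h
  exact h2

/-- Induction on the order, differentiating once under the integral at each step; the unweighted
seminorms dominate uniformly in `x`. -/
theorem iteratedFDeriv_integral {Ψ : Z → 𝓢(E, ℂ)} (hΨ : Continuous Ψ)
    (hb : ∀ l, ∃ b : Z → ℝ, Integrable b μ ∧ ∀ z, SchwartzMap.seminorm ℂ 0 l (Ψ z) ≤ b z)
    {Φ : E → ℂ} (hΦ : ∀ x, Φ x = ∫ z, Ψ z x ∂μ) (l : ℕ) (x : E) :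
    iteratedFDeriv ℝ l Φ x = ∫ z, iteratedFDeriv ℝ l (Ψ z) x ∂μ := by
  induction l generalizing x with
  | zero =>
    have h := ((continuousMultilinearCurryFin0 ℝ E ℂ).symm.toContinuousLinearEquiv).integral_comp_comm
      (fun z => Ψ z x) (μ := μ)
    rw [iteratedFDeriv_zero_eq_comp, Function.comp_apply, hΦ]
    refine h.symm.trans (integral_congr_ae (Filter.Eventually.of_forall fun z => ?_))
    simp only [iteratedFDeriv_zero_eq_comp]
    rfl
  | succ l ih =>
    have hfun : iteratedFDeriv ℝ l Φ = fun x => ∫ z, iteratedFDeriv ℝ l (Ψ z) x ∂μ := funext ih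
    have hsucc (z : Z) (y : E) : iteratedFDeriv ℝ (l + 1) (Ψ z) y =
      (continuousMultilinearCurryLeftEquiv ℝ (fun _ : Fin (l + 1) => E) ℂ).symm
        (fderiv ℝ (iteratedFDeriv ℝ l (Ψ z)) y) := rfl
    have hsucc' (z : Z) (y : E) : fderiv ℝ (iteratedFDeriv ℝ l (Ψ z)) y =
      (continuousMultilinearCurryLeftEquiv ℝ (fun _ : Fin (l + 1) => E) ℂ)
        (iteratedFDeriv ℝ (l + 1) (Ψ z) y) := by rw [hsucc]; simp
    obtain ⟨b, hbi, hble⟩ := hb (l + 1)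
    ext m
    have hfi (y : E) := integrable_iteratedFDeriv_apply hΨ (l + 1) (hb (l + 1)) y
    have hd := fderiv_integral_apply (F := fun z => iteratedFDeriv ℝ l (Ψ z)) hbi
      (fun y => integrable_iteratedFDeriv_apply hΨ l (hb l) y)
      (fun y => by
        simp only [hsucc']
        exact (LinearIsometryEquiv.continuous _).comp_aestronglyMeasurable
          (hfi y).aestronglyMeasurable)
      (fun z y => by
        rw [hsucc', LinearIsometryEquiv.norm_map]
        exact (SchwartzMap.norm_iteratedFDeriv_le_seminorm ℂ (Ψ z) (l + 1) y).trans (hble z))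
      (fun z => ((Ψ z).smooth ⊤).differentiable_iteratedFDeriv
          (m := l) (mod_cast WithTop.coe_lt_top _)) x (m 0)
    have hint : Integrable (fun z => fderiv ℝ (iteratedFDeriv ℝ l (Ψ z)) x (m 0)) μ := by
      have h := ((LinearIsometryEquiv.continuous (continuousMultilinearCurryLeftEquiv ℝ
        (fun _ : Fin (l + 1) => E) ℂ)).clm_apply continuous_const
          (g := fun _ => m 0)).comp_aestronglyMeasurable (hfi x).aestronglyMeasurable
      simp only [hsucc']
      refine (hbi.mul_const ‖m 0‖).mono' h (Filter.Eventually.of_forall fun z => ?_)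
      refine (ContinuousLinearMap.le_opNorm _ _).trans ?_
      rw [LinearIsometryEquiv.norm_map]
      gcongr
      exact (SchwartzMap.norm_iteratedFDeriv_le_seminorm ℂ (Ψ z) (l + 1) x).trans (hble z)
    rw [iteratedFDeriv_succ_apply_left, hfun, hd,
      ContinuousMultilinearMap.integral_apply hint,
      ContinuousMultilinearMap.integral_apply (hfi x)]
    simp only [iteratedFDeriv_succ_apply_left]

/-- A continuous functional on the Schwartz space commutes with integrals of Schwartz functions
that depend continuously on a parameter and are dominated in every seminorm. -/
theorem apply_eq_integral (f : 𝓢(E, ℂ) →L[ℂ] ℂ) {Ψ : Z → 𝓢(E, ℂ)} (hΨ : Continuous Ψ)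
    (hb : ∀ k l, ∃ b : Z → ℝ, Integrable b μ ∧ ∀ z, SchwartzMap.seminorm ℂ k l (Ψ z) ≤ b z)
    {Φ : 𝓢(E, ℂ)} (hΦ : ∀ x, Φ x = ∫ z, Ψ z x ∂μ) :
    f Φ = ∫ z, f (Ψ z) ∂μ := by
  -- Continuity of `f` involves only finitely many seminorms, so a finite product of Banach spaces
  -- can replace the Schwartz space as the place of integration.
  obtain ⟨s, C, -, hC⟩ := Seminorm.bound_of_continuous (schwartz_withSeminorms ℂ E ℂ)
    ((normSeminorm ℂ ℂ).comp f.toLinearMap) (by exact continuous_norm.comp f.continuous)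
  let J : 𝓢(E, ℂ) →L[ℝ] (i : s) → BoundedContinuousFunction E (DerivSpace E i.1.2) :=
    ContinuousLinearMap.pi fun i => weightedDerivCLM i.1.1 i.1.2
  have hJ (φ : 𝓢(E, ℂ)) : ‖f φ‖ ≤ C * ‖J φ‖ := by
    refine (hC φ).trans ?_
    rw [smul_apply]
    refine mul_le_mul_of_nonneg_left ?_ C.2
    refine Seminorm.finset_sup_apply_le (norm_nonneg _) fun i hi => ?_
    exact (seminorm_le_norm_weightedDerivCLM i.1 i.2 φ).trans (norm_le_pi_norm (J φ) ⟨i, hi⟩)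
  let T : 𝓢(E, ℂ) →L[ℝ] ((i : s) → BoundedContinuousFunction E (DerivSpace E i.1.2)) × ℂ :=
    J.prod (f.restrictScalars ℝ)
  let K := (LinearMap.range T.toLinearMap).topologicalClosure
  have hTK (φ : 𝓢(E, ℂ)) : T φ ∈ K := Submodule.le_topologicalClosure _ ⟨φ, rfl⟩
  -- The bound passes from the graph to its closure `K`, so an element of `K` with zero first
  -- component is zero. It is applied to `T Φ - ∫ T (Ψ z)`.
  have hK (p) (hp : p ∈ K) : ‖p.2‖ ≤ C * ‖p.1‖ := by
    have hcl : IsClosed {p : ((i : s) → BoundedContinuousFunction E (DerivSpace E i.1.2)) × ℂ |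
        ‖p.2‖ ≤ C * ‖p.1‖} := isClosed_le (by fun_prop) (by fun_prop)
    refine closure_minimal ?_ hcl hp
    rintro _ ⟨φ, rfl⟩
    exact hJ φ
  have hJi : Integrable (fun z => J (Ψ z)) μ :=
    Integrable.of_eval fun i => integrable_weightedDerivCLM hΨ _ _ (hb _ _)
  have hfi : Integrable (fun z => f (Ψ z)) μ :=
    (hJi.norm.const_mul (C : ℝ)).mono' (f.continuous.comp hΨ).aestronglyMeasurable
      (Filter.Eventually.of_forall fun z => hJ (Ψ z))
  have hTi : Integrable (fun z => T (Ψ z)) μ := hJi.prodMk hfi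
  have hmem := K.sub_mem (hTK Φ) (integral_mem_of_isClosed K
    (Submodule.isClosed_topologicalClosure _) (T.continuous.comp hΨ) hTi fun z => hTK (Ψ z))
  have h1 : (∫ z, T (Ψ z) ∂μ).1 = ∫ z, J (Ψ z) ∂μ := fst_integral hTi
  have h2 : (∫ z, T (Ψ z) ∂μ).2 = ∫ z, f (Ψ z) ∂μ := snd_integral hTi
  have h3 : J Φ = ∫ z, J (Ψ z) ∂μ := by
    funext i
    have he := eval_integral (μ := μ) (f := fun z => J (Ψ z)) (i := i)
      (fun i => integrable_weightedDerivCLM hΨ _ _ (hb _ _))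
    rw [he]
    ext1 x
    have h := (BoundedContinuousFunction.evalCLM ℝ x).integral_comp_comm
      (integrable_weightedDerivCLM hΨ i.1.1 i.1.2 (hb _ _))
    refine Eq.trans ?_ h
    change ‖x‖ ^ i.1.1 • schwartzDeriv i.1.2 Φ x = ∫ z, ‖x‖ ^ i.1.1 • schwartzDeriv i.1.2 (Ψ z) x ∂μ
    rw [integral_smul]
    congr 1
    exact iteratedFDeriv_integral hΨ (fun l => hb 0 l) hΦ _ _
  have h4 := hK _ hmem
  have h5 : (T Φ - ∫ z, T (Ψ z) ∂μ).1 = 0 := by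
    rw [Prod.fst_sub, h1, ← h3]; exact sub_self _
  simp only [Function.comp_apply] at h4
  rw [h5, norm_zero, mul_zero, Prod.snd_sub, h2] at h4
  exact sub_eq_zero.mp (norm_le_zero_iff.mp h4)

end Interchange

/-! ### Continuity of translations in the Schwartz topology -/

section Translation

open Topology Filter

variable {E : Type*} [NormedAddCommGroup E] [NormedSpace ℝ E]

theorem iteratedFDeriv_compSubConstCLM (a : E) (φ : 𝓢(E, ℂ)) (l : ℕ) (x : E) :
    iteratedFDeriv ℝ l (SchwartzMap.compSubConstCLM ℂ a φ) x = iteratedFDeriv ℝ l φ (x - a) :=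
  iteratedFDeriv_comp_sub (f := φ) l a x

theorem norm_pow_mul_iteratedFDeriv_sub_le (a : E) (φ : 𝓢(E, ℂ)) (k l : ℕ) (x : E) :
    ‖x‖ ^ k * ‖iteratedFDeriv ℝ l φ (x - a)‖ ≤
      2 ^ (k - 1) * (SchwartzMap.seminorm ℂ k l φ + ‖a‖ ^ k * SchwartzMap.seminorm ℂ 0 l φ) := by
  have h1 : ‖x‖ ^ k ≤ 2 ^ (k - 1) * (‖x - a‖ ^ k + ‖a‖ ^ k) := by
    refine le_trans ?_ (add_pow_le (norm_nonneg _) (norm_nonneg _) k)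
    gcongr
    simpa using norm_add_le (x - a) a
  calc ‖x‖ ^ k * ‖iteratedFDeriv ℝ l φ (x - a)‖
      ≤ 2 ^ (k - 1) * (‖x - a‖ ^ k + ‖a‖ ^ k) * ‖iteratedFDeriv ℝ l φ (x - a)‖ := by gcongr
    _ = 2 ^ (k - 1) * (‖x - a‖ ^ k * ‖iteratedFDeriv ℝ l φ (x - a)‖
          + ‖a‖ ^ k * ‖iteratedFDeriv ℝ l φ (x - a)‖) := by ring
    _ ≤ _ := by
      gcongr
      · exact SchwartzMap.le_seminorm ℂ k l φ _
      · exact SchwartzMap.norm_iteratedFDeriv_le_seminorm ℂ φ l _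

theorem seminorm_compSubConstCLM_le (a : E) (φ : 𝓢(E, ℂ)) (k l : ℕ) :
    SchwartzMap.seminorm ℂ k l (SchwartzMap.compSubConstCLM ℂ a φ) ≤
      2 ^ (k - 1) * (SchwartzMap.seminorm ℂ k l φ + ‖a‖ ^ k * SchwartzMap.seminorm ℂ 0 l φ) := by
  refine SchwartzMap.seminorm_le_bound ℂ k l _ (by positivity) fun x => ?_
  rw [iteratedFDeriv_compSubConstCLM]
  exact norm_pow_mul_iteratedFDeriv_sub_le a φ k l x

/-- Mean value inequality with the weight `w` frozen along the segment; it serves with `w = ‖x‖ ^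
k`, which does not move with `x - s • a`. -/
theorem mul_norm_image_sub_le {G : Type*} [NormedAddCommGroup G] [NormedSpace ℝ G] {F : E → G}
    (hF : Differentiable ℝ F) {w C : ℝ} (hw : 0 ≤ w) (x a : E)
    (hC : ∀ s ∈ Set.Icc (0 : ℝ) 1, w * ‖fderiv ℝ F (x - s • a)‖ ≤ C) :
    w * ‖F (x - a) - F x‖ ≤ C * ‖a‖ := by
  rcases hw.eq_or_lt with rfl | hw
  · have := hC 0 (by simp)
    rw [zero_mul] at this ⊢
    positivity
  have h := (convex_segment x (x - a)).norm_image_sub_le_of_norm_fderiv_le (𝕜 := ℝ) (f := F)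
    (C := C / w) (fun y _ => hF y) (fun y hy => by
      rw [segment_eq_image'] at hy
      obtain ⟨s, hs, rfl⟩ := hy
      have e : x + s • (x - a - x) = x - s • a := by module
      rw [le_div_iff₀ hw, mul_comm]
      beta_reduce
      rw [e]
      exact hC s hs) (left_mem_segment ℝ _ _) (right_mem_segment ℝ _ _)
  rw [sub_sub_cancel_left, norm_neg] at h
  calc w * ‖F (x - a) - F x‖ ≤ w * (C / w * ‖a‖) := by gcongr
    _ = C * ‖a‖ := by field_simp

theorem seminorm_compSubConstCLM_sub_le (a : E) (φ : 𝓢(E, ℂ)) (k l : ℕ) :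
    SchwartzMap.seminorm ℂ k l (SchwartzMap.compSubConstCLM ℂ a φ - φ) ≤
      2 ^ (k - 1) * (SchwartzMap.seminorm ℂ k (l + 1) φ +
        ‖a‖ ^ k * SchwartzMap.seminorm ℂ 0 (l + 1) φ) * ‖a‖ := by
  refine SchwartzMap.seminorm_le_bound ℂ k l _ (by positivity) fun x => ?_
  have h := iteratedFDeriv_sub_apply (𝕜 := ℝ) (i := l) (x := x)
    (f := SchwartzMap.compSubConstCLM ℂ a φ) (g := φ)
    (((SchwartzMap.compSubConstCLM ℂ a φ).smooth l).contDiffAt) ((φ.smooth l).contDiffAt)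
  rw [FunLike.coe_sub, h, iteratedFDeriv_compSubConstCLM]
  refine mul_norm_image_sub_le ((φ.smooth ⊤).differentiable_iteratedFDeriv
      (m := l) (mod_cast WithTop.coe_lt_top _)) (by positivity) x a fun s hs => ?_
  rw [norm_fderiv_iteratedFDeriv]
  refine (norm_pow_mul_iteratedFDeriv_sub_le _ _ _ _ _).trans ?_
  have : ‖s • a‖ ≤ ‖a‖ := by
    rw [norm_smul, Real.norm_of_nonneg hs.1]
    exact mul_le_of_le_one_left (norm_nonneg _) hs.2
  gcongr

theorem continuous_compSubConstCLM :
    Continuous fun p : E × 𝓢(E, ℂ) => SchwartzMap.compSubConstCLM ℂ p.1 p.2 := by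
  rw [continuous_iff_continuousAt]
  rintro ⟨a₀, φ₀⟩
  refine ((schwartz_withSeminorms ℂ E ℂ).tendsto_nhds _ _).mpr ?_
  rintro ⟨k, l⟩ ε hε
  simp only [SchwartzMap.schwartzSeminormFamily_apply]
  have hs (k l : ℕ) : Continuous (SchwartzMap.seminorm ℂ k l : 𝓢(E, ℂ) → ℝ) :=
    (schwartz_withSeminorms ℂ E ℂ).continuous_seminorm (k, l)
  set φ₁ := SchwartzMap.compSubConstCLM ℂ a₀ φ₀
  let R : E × 𝓢(E, ℂ) → ℝ := fun p =>
    2 ^ (k - 1) * (SchwartzMap.seminorm ℂ k l (p.2 - φ₀) +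
      ‖p.1‖ ^ k * SchwartzMap.seminorm ℂ 0 l (p.2 - φ₀)) +
    2 ^ (k - 1) * (SchwartzMap.seminorm ℂ k (l + 1) φ₁ +
        ‖p.1 - a₀‖ ^ k * SchwartzMap.seminorm ℂ 0 (l + 1) φ₁) * ‖p.1 - a₀‖
  have hR : Continuous R := by
    have := hs k l
    have := hs 0 l
    fun_prop
  have hR0 : R (a₀, φ₀) = 0 := by simp [R]
  have hlt : ∀ᶠ p in 𝓝 (a₀, φ₀), R p < ε :=
    (hR.tendsto (a₀, φ₀)).eventually_lt_const (by rwa [hR0])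
  filter_upwards [hlt] with p hp
  refine lt_of_le_of_lt ?_ hp
  -- Vary the function and the translation separately: the first term is small with `p.2 - φ₀`, the
  -- second with `p.1 - a₀` at the cost of one derivative.
  have hsplit : SchwartzMap.compSubConstCLM ℂ p.1 p.2 - φ₁ =
      SchwartzMap.compSubConstCLM ℂ p.1 (p.2 - φ₀) +
        (SchwartzMap.compSubConstCLM ℂ (p.1 - a₀) φ₁ - φ₁) := by
    rw [SchwartzMap.compSubConstCLM_comp, map_sub, add_sub_cancel]
    abel
  rw [hsplit]
  exact (map_add_le_add _ _ _).trans (add_le_add (seminorm_compSubConstCLM_le _ _ _ _)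
    (seminorm_compSubConstCLM_sub_le _ _ _ _))

/-- `φ` and the translate of `G` live far apart when `a` is large; Peetre's inequality turns this
into decay in `a` of any order, which gives integrability in the translation parameter. -/
theorem one_add_norm_pow_mul_seminorm_le (φ G : 𝓢(E, ℂ)) (k l N : ℕ) :
    ∃ C : ℝ, ∀ a : E, SchwartzMap.seminorm ℂ k l
      (SchwartzMap.smulLeftCLM ℂ φ (SchwartzMap.compSubConstCLM ℂ a G)) ≤
        C * ((1 + ‖a‖) ^ N)⁻¹ := by
  set A := 2 ^ (N + k) *
    ((Finset.Iic (N + k, l)).sup fun m => SchwartzMap.seminorm ℂ m.1 m.2) φ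
  set B := 2 ^ N * ((Finset.Iic (N, l)).sup fun m => SchwartzMap.seminorm ℂ m.1 m.2) G
  have hA (x : E) (i : ℕ) (hi : i ≤ l) : (1 + ‖x‖) ^ (N + k) * ‖iteratedFDeriv ℝ i φ x‖ ≤ A :=
    SchwartzMap.one_add_le_sup_seminorm_apply (m := (N + k, l)) le_rfl hi φ x
  have hB (x : E) (i : ℕ) (hi : i ≤ l) : (1 + ‖x‖) ^ N * ‖iteratedFDeriv ℝ i G x‖ ≤ B :=
    SchwartzMap.one_add_le_sup_seminorm_apply (m := (N, l)) le_rfl hi G x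
  have hA0 : 0 ≤ A := by positivity
  have hB0 : 0 ≤ B := by positivity
  refine ⟨2 ^ l * (A * B), fun a => SchwartzMap.seminorm_le_bound ℂ k l _ (by positivity)
    fun x => ?_⟩
  have hcoe : (⇑(SchwartzMap.smulLeftCLM ℂ φ (SchwartzMap.compSubConstCLM ℂ a G)) : E → ℂ) =
      fun x => φ x * SchwartzMap.compSubConstCLM ℂ a G x := by
    funext x
    rw [SchwartzMap.smulLeftCLM_apply_apply φ.hasTemperateGrowth, smul_eq_mul]
  have hpeetre : (1 + ‖a‖) ^ N ≤ (1 + ‖x‖) ^ N * (1 + ‖x - a‖) ^ N := by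
    rw [← mul_pow]
    gcongr
    have h : ‖a‖ ≤ ‖x‖ + ‖x - a‖ := by simpa using norm_sub_le x (x - a)
    nlinarith [norm_nonneg x, norm_nonneg (x - a)]
  have hxk : ‖x‖ ^ k ≤ (1 + ‖x‖) ^ k := by gcongr; linarith
  rw [← div_eq_mul_inv, le_div_iff₀ (by positivity), hcoe]
  have hmul := norm_iteratedFDeriv_mul_le (𝕜 := ℝ) (N := l) (n := l) (φ.smooth l)
    ((SchwartzMap.compSubConstCLM ℂ a G).smooth l) x le_rfl
  calc ‖x‖ ^ k * ‖iteratedFDeriv ℝ l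
        (fun x => φ x * SchwartzMap.compSubConstCLM ℂ a G x) x‖ * (1 + ‖a‖) ^ N
      ≤ (1 + ‖x‖) ^ k * (∑ i ∈ Finset.range (l + 1), (l.choose i : ℝ) * ‖iteratedFDeriv ℝ i φ x‖ *
          ‖iteratedFDeriv ℝ (l - i) (SchwartzMap.compSubConstCLM ℂ a G) x‖) *
          ((1 + ‖x‖) ^ N * (1 + ‖x - a‖) ^ N) := by gcongr
    _ = ∑ i ∈ Finset.range (l + 1), (l.choose i : ℝ) *
          (((1 + ‖x‖) ^ (N + k) * ‖iteratedFDeriv ℝ i φ x‖) *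
          ((1 + ‖x - a‖) ^ N * ‖iteratedFDeriv ℝ (l - i) G (x - a)‖)) := by
        rw [Finset.mul_sum, Finset.sum_mul]
        refine Finset.sum_congr rfl fun i _ => ?_
        rw [iteratedFDeriv_compSubConstCLM, pow_add]
        ring
    _ ≤ ∑ i ∈ Finset.range (l + 1), (l.choose i : ℝ) * (A * B) := by
        refine Finset.sum_le_sum fun i hi => ?_
        have hi' : i ≤ l := by simpa [Nat.lt_succ_iff] using hi
        have := hA x i hi'
        have := hB (x - a) (l - i) (Nat.sub_le _ _)
        gcongr
    _ = 2 ^ l * (A * B) := by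
        rw [← Finset.sum_mul]
        congr 1
        exact_mod_cast Nat.sum_range_choose l

end Translation

/-! ### Inversion of the short-time Fourier transform -/

section Reproducing

open FourierTransform

variable {E : Type*} [NormedAddCommGroup E] [InnerProductSpace ℝ E]

/-- The character `y ↦ e^{2πi ⟨η, y⟩}`. -/
def character (η y : E) : ℂ := Complex.exp (Complex.I * ((2 * Real.pi * ⟪η, y⟫_ℝ : ℝ) : ℂ))

theorem character_hasTemperateGrowth (η : E) : (character η).HasTemperateGrowth := by
  have h : (fun y : E => 2 * Real.pi * ⟪η, y⟫_ℝ).HasTemperateGrowth := by fun_prop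
  exact hasTemperateGrowth_cexp_I_comp h

/-- Multiplication by a character on the Schwartz space. -/
def modulateCLM (η : E) : 𝓢(E, ℂ) →L[ℂ] 𝓢(E, ℂ) := SchwartzMap.smulLeftCLM ℂ (character η)

theorem modulateCLM_apply (η : E) (γ : 𝓢(E, ℂ)) (y : E) :
    modulateCLM η γ y = character η y * γ y := by
  rw [modulateCLM, SchwartzMap.smulLeftCLM_apply_apply (character_hasTemperateGrowth η),
    smul_eq_mul]

variable [FiniteDimensional ℝ E] [MeasurableSpace E] [BorelSpace E]

theorem fourier_modulateCLM (η : E) (γ : 𝓢(E, ℂ)) :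
    𝓕 (modulateCLM η γ) = SchwartzMap.compSubConstCLM ℂ η (𝓕 γ) := by
  ext ζ
  rw [SchwartzMap.compSubConstCLM_apply, SchwartzMap.fourier_coe, SchwartzMap.fourier_coe,
    Real.fourier_eq', Real.fourier_eq']
  congr 1
  funext y
  rw [modulateCLM_apply, smul_eq_mul, smul_eq_mul, ← mul_assoc, character, ← Complex.exp_add,
    inner_sub_right, real_inner_comm η y]
  congr 2
  push_cast
  ring

theorem fourierInv_compSubConstCLM (η : E) (γ : 𝓢(E, ℂ)) :
    𝓕⁻ (SchwartzMap.compSubConstCLM ℂ η γ) = modulateCLM η (𝓕⁻ γ) := by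
  have h := fourier_modulateCLM η (𝓕⁻ γ)
  rw [FourierTransform.fourier_fourierInv_eq] at h
  rw [← h, FourierTransform.fourierInv_fourier_eq]

/-- The Fourier transform turns modulations into translations, whose continuity is known. -/
theorem continuous_modulateCLM (γ : 𝓢(E, ℂ)) : Continuous fun η : E => modulateCLM η γ := by
  have h : (fun η : E => modulateCLM η γ) =
      fun η => FourierTransform.fourierInvCLM ℂ 𝓢(E, ℂ) (SchwartzMap.compSubConstCLM ℂ η (𝓕 γ)) := by
    funext η
    have h := fourierInv_compSubConstCLM η (𝓕 γ)
    rw [FourierTransform.fourierInv_fourier_eq] at h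
    exact h.symm
  rw [h]
  exact (ContinuousLinearMap.continuous _).comp
    (continuous_compSubConstCLM.comp (by fun_prop : Continuous fun η : E => (η, 𝓕 γ)))

/-- The functional `u` commutes with convolutions. -/
theorem apply_convolution (u : 𝓢(E, ℂ) →L[ℂ] ℂ) (φ ψ : 𝓢(E, ℂ)) :
    u (SchwartzMap.convolution (ContinuousLinearMap.mul ℂ ℂ) φ ψ) =
      ∫ y, φ y * u (SchwartzMap.compSubConstCLM ℂ y ψ) := by
  have h := apply_eq_integral (μ := volume) u
    (Ψ := fun y : E => φ y • SchwartzMap.compSubConstCLM ℂ y ψ)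
    (Φ := SchwartzMap.convolution (ContinuousLinearMap.mul ℂ ℂ) φ ψ)
    (φ.continuous.smul (continuous_compSubConstCLM.comp
      (by fun_prop : Continuous fun y : E => (y, ψ))))
    (fun k l => ⟨fun y => ‖φ y‖ * (2 ^ (k - 1) * (SchwartzMap.seminorm ℂ k l ψ +
        ‖y‖ ^ k * SchwartzMap.seminorm ℂ 0 l ψ)), ?_, fun y => ?_⟩) (fun x => ?_)
  · rw [h]
    simp
  · have h0 := (φ.integrable (μ := volume)).norm.mul_const
      (2 ^ (k - 1) * SchwartzMap.seminorm ℂ k l ψ)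
    have h1 := (φ.integrable_pow_mul volume k).mul_const
      (2 ^ (k - 1) * SchwartzMap.seminorm ℂ 0 l ψ)
    refine (h0.add h1).congr (Filter.Eventually.of_forall fun y => ?_)
    simp only [Pi.add_apply]
    ring
  · rw [map_smul_eq_mul]
    exact mul_le_mul_of_nonneg_left (seminorm_compSubConstCLM_le _ _ _ _) (norm_nonneg _)
  · rw [SchwartzMap.convolution_apply]
    rfl

/-- Pointwise `∫ φ(x) G(x - η) dη = φ(x) ∫ G`; the functional is then taken out of the integral. -/
theorem integral_apply_smulLeftCLM_compSubConstCLM (v : 𝓢(E, ℂ) →L[ℂ] ℂ) (φ G : 𝓢(E, ℂ)) :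
    ∫ η, v (SchwartzMap.smulLeftCLM ℂ φ (SchwartzMap.compSubConstCLM ℂ η G)) =
      v φ * ∫ η, G η := by
  have h := apply_eq_integral (μ := volume) v
    (Ψ := fun η : E => SchwartzMap.smulLeftCLM ℂ φ (SchwartzMap.compSubConstCLM ℂ η G))
    (Φ := (∫ η, G η) • φ)
    ((SchwartzMap.smulLeftCLM ℂ φ).continuous.comp (continuous_compSubConstCLM.comp
      (by fun_prop : Continuous fun y : E => (y, G))))
    (fun k l => ?_) (fun x => ?_)
  · rw [← h, map_smul, smul_eq_mul, mul_comm]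
  · obtain ⟨C, hC⟩ := one_add_norm_pow_mul_seminorm_le φ G k l (Module.finrank ℝ E + 1)
    refine ⟨_, ?_, hC⟩
    have := integrable_one_add_norm (E := E) (μ := volume) (r := Module.finrank ℝ E + 1)
      (by simp)
    refine (this.const_mul C).congr (Filter.Eventually.of_forall fun η => ?_)
    simp only
    rw [Real.rpow_neg (by positivity)]
    norm_cast
  · simp only [SchwartzMap.smulLeftCLM_apply_apply φ.hasTemperateGrowth,
      SchwartzMap.compSubConstCLM_apply, smul_eq_mul]
    rw [integral_const_mul, integral_sub_left_eq_self G volume x, smul_apply,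
      smul_eq_mul, mul_comm]

/-- The short-time Fourier inversion formula for tempered distributions, in weak form. -/
theorem integral_integral_apply_modulateCLM (u : 𝓢(E, ℂ) →L[ℂ] ℂ) (φ γ : 𝓢(E, ℂ)) :
    ∫ η, ∫ y, φ y * u (SchwartzMap.compSubConstCLM ℂ y (modulateCLM η γ)) = γ 0 * u φ := by
  -- The inner integral is `u (φ * M_η γ)`, and this convolution has Fourier transform `𝓕 φ` times
  -- the `η`-translate of `𝓕 γ`. Integrating over `η` leaves `∫ 𝓕 γ = γ 0`.
  have h1 (η : E) : ∫ y, φ y * u (SchwartzMap.compSubConstCLM ℂ y (modulateCLM η γ)) =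
      (u ∘L FourierTransform.fourierInvCLM ℂ 𝓢(E, ℂ))
        (SchwartzMap.smulLeftCLM ℂ (𝓕 φ : 𝓢(E, ℂ)) (SchwartzMap.compSubConstCLM ℂ η (𝓕 γ))) := by
    rw [← apply_convolution, ← fourier_modulateCLM, ContinuousLinearMap.comp_apply]
    congr 1
    rw [FourierTransform.fourierInvCLM_apply]
    change 𝓕⁻ (SchwartzMap.pairing (ContinuousLinearMap.mul ℂ ℂ) (𝓕 φ)
      (𝓕 (modulateCLM η γ))) = _
    congr 1
    ext x
    rw [SchwartzMap.smulLeftCLM_apply_apply (𝓕 φ : 𝓢(E, ℂ)).hasTemperateGrowth]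
    rfl
  simp_rw [h1]
  rw [integral_apply_smulLeftCLM_compSubConstCLM, ContinuousLinearMap.comp_apply, mul_comm]
  congr 1
  · have h2 : γ 0 = (𝓕⁻ (𝓕 γ)) 0 := by rw [FourierTransform.fourierInv_fourier_eq]
    rw [h2, SchwartzMap.fourierInv_coe, Real.fourierInv_eq']
    simp
  · congr 1
    rw [FourierTransform.fourierInvCLM_apply, FourierTransform.fourierInv_fourier_eq]

end Reproducing

/-! ### Sup bound from the inversion formula -/

section LInfty

variable {n : ℕ}

theorem continuous_apply_modulateCLM (u : 𝓢(Rn n, ℂ) →L[ℂ] ℂ) (γ : 𝓢(Rn n, ℂ)) :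
    Continuous fun p : Rn n × Rn n =>
      u (SchwartzMap.compSubConstCLM ℂ p.1 (modulateCLM p.2 γ)) :=
  u.continuous.comp (continuous_compSubConstCLM.comp
    (continuous_fst.prodMk ((continuous_modulateCLM γ).comp continuous_snd)))

theorem integrable_mul_apply_modulateCLM (u : 𝓢(Rn n, ℂ) →L[ℂ] ℂ) (γ φ : 𝓢(Rn n, ℂ))
    (hN : ∫⁻ η : Rn n, ⨆ y : Rn n,
      ‖u (SchwartzMap.compSubConstCLM ℂ y (modulateCLM η γ))‖ₑ ≠ ∞) :
    Integrable (fun p : Rn n × Rn n =>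
      φ p.1 * u (SchwartzMap.compSubConstCLM ℂ p.1 (modulateCLM p.2 γ)))
      ((volume : Measure (Rn n)).prod (volume : Measure (Rn n))) := by
  have hc : Continuous (fun p : Rn n × Rn n =>
      φ p.1 * u (SchwartzMap.compSubConstCLM ℂ p.1 (modulateCLM p.2 γ))) :=
    (φ.continuous.comp continuous_fst).mul (continuous_apply_modulateCLM u γ)
  refine ⟨hc.aestronglyMeasurable, ?_⟩
  rw [hasFiniteIntegral_iff_enorm, lintegral_prod_symm _ hc.aestronglyMeasurable.enorm]
  have hφ : ∫⁻ y, ‖φ y‖ₑ < ∞ := (φ.integrable (μ := volume)).2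
  calc ∫⁻ η : Rn n, ∫⁻ y : Rn n,
        ‖φ y * u (SchwartzMap.compSubConstCLM ℂ y (modulateCLM η γ))‖ₑ
      ≤ ∫⁻ η : Rn n, (∫⁻ y, ‖φ y‖ₑ) * ⨆ y : Rn n,
          ‖u (SchwartzMap.compSubConstCLM ℂ y (modulateCLM η γ))‖ₑ := by
        refine lintegral_mono fun η => ?_
        rw [← lintegral_mul_const'' _ φ.continuous.aestronglyMeasurable.enorm]
        refine lintegral_mono fun y => ?_
        rw [enorm_mul]
        gcongr
        exact le_iSup (fun y : Rn n =>
          ‖u (SchwartzMap.compSubConstCLM ℂ y (modulateCLM η γ))‖ₑ) y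
    _ = (∫⁻ y, ‖φ y‖ₑ) * ∫⁻ η : Rn n, ⨆ y : Rn n,
          ‖u (SchwartzMap.compSubConstCLM ℂ y (modulateCLM η γ))‖ₑ :=
        lintegral_const_mul' _ _ hφ.ne
    _ < ∞ := ENNReal.mul_lt_top hφ hN.lt_top

/-- The inversion formula, after Fubini, exhibits `u` as the function `h` below, and the triangle
inequality bounds `h` pointwise. -/
theorem lInftyNorm_le_of_apply_modulateCLM (u : 𝓢'(Rn n, ℂ)) (γ : 𝓢(Rn n, ℂ)) (hγ : γ 0 ≠ 0)
    {N : ℝ≥0∞}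
    (hN : ∫⁻ η : Rn n, ⨆ y : Rn n,
      ‖u (SchwartzMap.compSubConstCLM ℂ y (modulateCLM η γ))‖ₑ ≤ N) :
    lInftyNorm u ≤ ‖γ 0‖ₑ⁻¹ * N := by
  rcases eq_or_ne N ∞ with rfl | hN'
  · rw [ENNReal.mul_top (by simp)]
    exact le_top
  set W : Rn n × Rn n → ℂ := fun p =>
    u (SchwartzMap.compSubConstCLM ℂ p.1 (modulateCLM p.2 γ))
  have hWc : Continuous W := continuous_apply_modulateCLM u γ
  let h : Rn n → ℂ := fun y => (γ 0)⁻¹ * ∫ η, W (y, η)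
  have hm : StronglyMeasurable h :=
    stronglyMeasurable_const.mul hWc.stronglyMeasurable.integral_prod_right'
  have hle (y : Rn n) : ‖h y‖ₑ ≤ ‖γ 0‖ₑ⁻¹ * N := by
    rw [enorm_mul, enorm_inv hγ]
    gcongr
    refine (enorm_integral_le_lintegral_enorm _).trans (le_trans ?_ hN)
    exact lintegral_mono fun η => le_iSup (fun y : Rn n => ‖W (y, η)‖ₑ) y
  have hess : eLpNorm h ∞ volume ≤ ‖γ 0‖ₑ⁻¹ * N := by
    rw [eLpNorm_exponent_top]
    exact eLpNormEssSup_le_of_ae_enorm_bound (Filter.Eventually.of_forall hle)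
  have hmem : MemLp h ∞ volume := ⟨hm.aestronglyMeasurable,
    hess.trans_lt (ENNReal.mul_lt_top (by simpa using hγ) hN'.lt_top)⟩
  refine (iInf₂_le (hmem.toLp h) ?_).trans (by rwa [Lp.enorm_toLp])
  ext φ
  rw [Lp.toTemperedDistribution_apply]
  have h1 : ∫ y, φ y • (hmem.toLp h) y = ∫ y, (γ 0)⁻¹ * ∫ η, φ y * W (y, η) := by
    refine integral_congr_ae ?_
    filter_upwards [hmem.coeFn_toLp] with y hy
    rw [hy, integral_const_mul, smul_eq_mul]
    ring
  rw [h1, integral_const_mul, integral_integral_swap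
    (integrable_mul_apply_modulateCLM u γ φ (ne_top_of_le_ne_top hN' hN))]
  refine (congrArg _ (integral_integral_apply_modulateCLM u φ γ)).trans ?_
  rw [inv_mul_cancel_left₀ hγ]
  rfl

end LInfty

/-! ### Covariance of the propagator under phase space shifts -/

section Propagator

open FourierTransform

variable {n : ℕ}

/-- The dual of the free propagator on the Schwartz space. -/
def dualPropagator (n : ℕ) (ħ t : ℝ) : 𝓢(Rn n, ℂ) →L[ℂ] 𝓢(Rn n, ℂ) :=
  fourierCLM ℂ 𝓢(Rn n, ℂ) ∘L SchwartzMap.smulLeftCLM ℂ (schrodingerSymbol ħ t) ∘L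
    fourierInvCLM ℂ 𝓢(Rn n, ℂ)

theorem schrodingerPropagator_apply (ħ t : ℝ) (f : 𝓢'(Rn n, ℂ)) (φ : 𝓢(Rn n, ℂ)) :
    schrodingerPropagator n ħ t f φ = f (dualPropagator n ħ t φ) := rfl

theorem fourierInv_dualPropagator (ħ t : ℝ) (φ : 𝓢(Rn n, ℂ)) :
    𝓕⁻ (dualPropagator n ħ t φ) =
      SchwartzMap.smulLeftCLM ℂ (schrodingerSymbol ħ t) (𝓕⁻ φ) := by
  change 𝓕⁻ (𝓕 (SchwartzMap.smulLeftCLM ℂ (schrodingerSymbol ħ t) (𝓕⁻ φ))) = _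
  rw [fourierInv_fourier_eq]

theorem fourierInv_dualPropagator_apply (ħ t : ℝ) (φ : 𝓢(Rn n, ℂ)) (ζ : Rn n) :
    𝓕⁻ (dualPropagator n ħ t φ) ζ = schrodingerSymbol ħ t ζ * 𝓕⁻ φ ζ := by
  rw [fourierInv_dualPropagator, SchwartzMap.smulLeftCLM_apply_apply
    (schrodingerSymbol_hasTemperateGrowth ħ t), smul_eq_mul]

theorem schrodingerSymbol_mul_neg (ħ t : ℝ) (ζ : Rn n) :
    schrodingerSymbol ħ t ζ * schrodingerSymbol ħ (-t) ζ = 1 := by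
  rw [schrodingerSymbol, schrodingerSymbol, ← Complex.exp_add, ← Complex.exp_zero]
  congr 1
  push_cast
  ring

theorem fourierInv_injective : Function.Injective (𝓕⁻ : 𝓢(Rn n, ℂ) → 𝓢(Rn n, ℂ)) := by
  intro φ ψ h
  simpa [fourier_fourierInv_eq] using congrArg (fun g : 𝓢(Rn n, ℂ) => (𝓕 g : 𝓢(Rn n, ℂ))) h

theorem dualPropagator_dualPropagator_neg (ħ t : ℝ) (φ : 𝓢(Rn n, ℂ)) :
    dualPropagator n ħ t (dualPropagator n ħ (-t) φ) = φ := by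
  apply fourierInv_injective
  ext ζ
  rw [fourierInv_dualPropagator_apply, fourierInv_dualPropagator_apply, ← mul_assoc,
    schrodingerSymbol_mul_neg, one_mul]

theorem fourierInv_modulateCLM_apply (η : Rn n) (γ : 𝓢(Rn n, ℂ)) (ζ : Rn n) :
    𝓕⁻ (modulateCLM η γ) ζ = 𝓕⁻ γ (ζ + η) := by
  have h := fourier_modulateCLM η γ
  have h2 := congrArg (fun g : 𝓢(Rn n, ℂ) => g (-ζ)) h
  simp only [SchwartzMap.compSubConstCLM_apply] at h2
  rw [SchwartzMap.fourierInv_apply_eq, SchwartzMap.fourierInv_apply_eq]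
  simp only [SchwartzMap.compCLMOfContinuousLinearEquiv_apply, Function.comp_apply]
  simp only [LinearIsometryEquiv.coe_toContinuousLinearEquiv, LinearIsometryEquiv.coe_neg]
  rw [h2, neg_add, sub_eq_add_neg]

/-- The propagator maps phase space shifts to phase space shifts. -/
theorem dualPropagator_compSubConstCLM_modulateCLM (ħ t : ℝ) (y η : Rn n) (γ : 𝓢(Rn n, ℂ)) :
    dualPropagator n ħ t (SchwartzMap.compSubConstCLM ℂ y (modulateCLM η γ)) =
      schrodingerSymbol ħ (-t) η • SchwartzMap.compSubConstCLM ℂ (y + (2 * Real.pi * ħ * t) • η)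
        (modulateCLM η (dualPropagator n ħ t γ)) := by
  apply fourierInv_injective
  ext ζ
  rw [fourierInv_dualPropagator_apply, fourierInv_compSubConstCLM, modulateCLM_apply,
    fourierInv_smul, smul_apply, fourierInv_compSubConstCLM, modulateCLM_apply,
    fourierInv_modulateCLM_apply, fourierInv_modulateCLM_apply, fourierInv_dualPropagator_apply,
    smul_eq_mul]
  simp only [← mul_assoc]
  congr 1
  simp only [schrodingerSymbol, character, ← Complex.exp_add]
  congr 1
  -- The cross term of `‖ζ + η‖ ^ 2` is cancelled by the displacement `2πħtη`, and `‖η‖ ^ 2` by the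
  -- scalar factor.
  rw [inner_add_left, inner_smul_left, norm_add_sq_real, real_inner_comm η ζ]
  simp only [conj_trivial]
  push_cast
  ring

theorem norm_schrodingerSymbol (ħ t : ℝ) (ζ : Rn n) : ‖schrodingerSymbol ħ t ζ‖ = 1 := by
  rw [schrodingerSymbol, mul_comm, Complex.norm_exp_ofReal_mul_I]

end Propagator

/-! ### The Sjöstrand norm in terms of translations and modulations -/

section Gabor

variable {n : ℕ}

theorem lintegral_comp_smul {r : ℝ} (hr : r ≠ 0) (F : Rn n → ℝ≥0∞) :
    ∫⁻ ξ, F (r • ξ) = ENNReal.ofReal (|r ^ n|⁻¹) * ∫⁻ η, F η := by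
  have h := lintegral_map_equiv (μ := (volume : Measure (Rn n))) F
    (Homeomorph.smulOfNeZero r hr).toMeasurableEquiv
  have h2 : Measure.map (Homeomorph.smulOfNeZero r hr).toMeasurableEquiv
      (volume : Measure (Rn n)) = ENNReal.ofReal (|r ^ n|⁻¹) • volume := by
    have := Measure.map_addHaar_smul (volume : Measure (Rn n)) hr
    rw [finrank_euclideanSpace_fin, abs_inv] at this
    exact this
  rw [h2, lintegral_smul_measure] at h
  exact h.symm

theorem conj_phaseShift (ħ : ℝ) {g : 𝓢(Rn n, ℂ)} (hg : conj g = g) (x ξ : Rn n) :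
    conj (phaseShift ħ x ξ g) =
      ((((2 * Real.pi * ħ) ^ (-(n : ℝ) / 2) : ℝ) : ℂ) *
        Complex.exp (Complex.I * ((-ħ⁻¹ * ⟪ξ, x⟫_ℝ : ℝ) : ℂ))) •
      SchwartzMap.compSubConstCLM ℂ x (modulateCLM (-(2 * Real.pi * ħ)⁻¹ • ξ) g) := by
  ext y
  have hgy : (starRingEnd ℂ) (g (y - x)) = g (y - x) := by
    rw [← conj_apply, hg]
  rw [conj_apply, phaseShift_apply, smul_apply, SchwartzMap.compSubConstCLM_apply,
    modulateCLM_apply, map_mul, hgy, modulation, map_mul, Complex.conj_ofReal, smul_eq_mul,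
    ← Complex.exp_conj, map_mul, Complex.conj_I, Complex.conj_ofReal, character,
    ← mul_assoc, mul_assoc _ (Complex.exp _) (Complex.exp _), ← Complex.exp_add]
  congr 3
  rw [inner_smul_left, inner_sub_right]
  have hpi : (Real.pi : ℂ) ≠ 0 := mod_cast Real.pi_ne_zero
  simp only [conj_trivial]
  push_cast
  rw [mul_inv, mul_inv]
  linear_combination (-(Complex.I * (ħ : ℂ)⁻¹ * (⟪ξ, x⟫_ℝ - ⟪ξ, y⟫_ℝ))) *
    (mul_inv_cancel₀ (mul_ne_zero two_ne_zero hpi))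

theorem enorm_gabor {ħ : ℝ} (hħ : 0 < ħ) {g : 𝓢(Rn n, ℂ)} (hg : conj g = g) (f : 𝓢'(Rn n, ℂ))
    (x ξ : Rn n) :
    ‖gabor ħ g f x ξ‖ₑ = ENNReal.ofReal ((2 * Real.pi * ħ) ^ (-(n : ℝ) / 2)) *
      ‖f (SchwartzMap.compSubConstCLM ℂ x (modulateCLM (-(2 * Real.pi * ħ)⁻¹ • ξ) g))‖ₑ := by
  have h0 : 0 ≤ (2 * Real.pi * ħ) ^ (-(n : ℝ) / 2) := by positivity
  rw [gabor, conj_phaseShift ħ hg, map_smul, smul_eq_mul, enorm_mul, enorm_mul]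
  congr 1
  have h1 : ‖Complex.exp (Complex.I * ((-ħ⁻¹ * ⟪ξ, x⟫_ℝ : ℝ) : ℂ))‖ₑ = 1 := by
    rw [← ofReal_norm, mul_comm, Complex.norm_exp_ofReal_mul_I, ENNReal.ofReal_one]
  rw [h1, mul_one, ← ofReal_norm, Complex.norm_real, Real.norm_of_nonneg h0]

theorem lintegral_iSup_apply_modulateCLM {ħ : ℝ} (hħ : 0 < ħ) {g : 𝓢(Rn n, ℂ)} (hg : conj g = g)
    (f : 𝓢'(Rn n, ℂ)) :
    ∫⁻ η : Rn n, ⨆ x : Rn n, ‖f (SchwartzMap.compSubConstCLM ℂ x (modulateCLM η g))‖ₑ =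
      ENNReal.ofReal ((2 * Real.pi * ħ) ^ (-(n : ℝ) / 2)) * sjostrandNorm ħ g f := by
  have hp : 0 < 2 * Real.pi * ħ := by positivity
  set S : Rn n → ℝ≥0∞ := fun η =>
    ⨆ x : Rn n, ‖f (SchwartzMap.compSubConstCLM ℂ x (modulateCLM η g))‖ₑ with hS
  have h : sjostrandNorm ħ g f = ENNReal.ofReal ((2 * Real.pi * ħ) ^ (-(n : ℝ) / 2)) *
      ∫⁻ ξ : Rn n, S (-(2 * Real.pi * ħ)⁻¹ • ξ) := by
    rw [sjostrandNorm, ← lintegral_const_mul' _ _ ENNReal.ofReal_ne_top]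
    simp only [hS, enorm_gabor hħ hg, ENNReal.mul_iSup]
  rw [h, lintegral_comp_smul (neg_ne_zero.mpr (inv_ne_zero hp.ne')), ← mul_assoc, ← mul_assoc,
    ← ENNReal.ofReal_mul (by positivity), ← ENNReal.ofReal_mul (by positivity)]
  -- The substitution `η = -ξ/(2πħ)` has Jacobian factor `(2πħ)^n`, which absorbs both
  -- normalizations.
  have h1 : (2 * Real.pi * ħ) ^ (-(n : ℝ) / 2) * (2 * Real.pi * ħ) ^ (-(n : ℝ) / 2) *
      |(-(2 * Real.pi * ħ)⁻¹) ^ n|⁻¹ = 1 := by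
    rw [abs_pow, abs_neg, abs_of_pos (inv_pos.mpr hp), inv_pow, inv_inv, ← Real.rpow_add hp,
      ← Real.rpow_natCast, ← Real.rpow_add hp]
    ring_nf
    exact Real.rpow_zero _
  rw [h1, ENNReal.ofReal_one, one_mul]

theorem iSup_apply_dualPropagator_le (ħ t : ℝ) (f : 𝓢'(Rn n, ℂ)) (γ : 𝓢(Rn n, ℂ)) (η : Rn n) :
    ⨆ y : Rn n, ‖schrodingerPropagator n ħ t f
      (SchwartzMap.compSubConstCLM ℂ y (modulateCLM η γ))‖ₑ ≤
    ⨆ x : Rn n, ‖f (SchwartzMap.compSubConstCLM ℂ x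
      (modulateCLM η (dualPropagator n ħ t γ)))‖ₑ := by
  refine iSup_le fun y => ?_
  rw [schrodingerPropagator_apply, dualPropagator_compSubConstCLM_modulateCLM, map_smul,
    smul_eq_mul, enorm_mul]
  have h1 : ‖schrodingerSymbol ħ (-t) η‖ₑ = 1 := by
    rw [← ofReal_norm, norm_schrodingerSymbol, ENNReal.ofReal_one]
  rw [h1, one_mul]
  exact le_iSup (fun x : Rn n => ‖f (SchwartzMap.compSubConstCLM ℂ x
      (modulateCLM η (dualPropagator n ħ t γ)))‖ₑ) _

/-- Analysing the solution with the window evolved by `-t` makes the dual propagator return `g`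
itself. -/
theorem lInftyNorm_schrodingerPropagator_le {ħ : ℝ} (hħ : 0 < ħ) (t : ℝ) {g : 𝓢(Rn n, ℂ)}
    (hg : conj g = g) (h0 : dualPropagator n ħ (-t) g 0 ≠ 0) (f : 𝓢'(Rn n, ℂ)) :
    lInftyNorm (schrodingerPropagator n ħ t f) ≤ ‖dualPropagator n ħ (-t) g 0‖ₑ⁻¹ *
      (ENNReal.ofReal ((2 * Real.pi * ħ) ^ (-(n : ℝ) / 2)) * sjostrandNorm ħ g f) := by
  refine lInftyNorm_le_of_apply_modulateCLM _ _ h0 ?_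
  rw [← lintegral_iSup_apply_modulateCLM hħ hg]
  refine lintegral_mono fun η => (iSup_apply_dualPropagator_le ħ t f _ η).trans ?_
  rw [dualPropagator_dualPropagator_neg]

end Gabor

/-! ### Complex Gaussian integrals -/

section Gaussian

open FourierTransform

variable {n : ℕ}

theorem integral_cexp_quadratic_euclidean {b : Fin n → ℂ} (hb : ∀ j, 0 < (b j).re)
    (c : Fin n → ℂ) :
    ∫ v : Rn n, Complex.exp (-∑ j, b j * (v j : ℂ) ^ 2 + ∑ j, c j * (v j : ℂ)) =
      ∏ j, (Real.pi / b j) ^ (1 / 2 : ℂ) * Complex.exp (c j ^ 2 / (4 * b j)) := by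
  rw [← (PiLp.volume_preserving_toLp (Fin n)).integral_comp
    (MeasurableEquiv.toLp 2 _).measurableEmbedding]
  exact GaussianFourier.integral_cexp_neg_sum_mul_add hb c

theorem fourier_cexp_quadratic {G : 𝓢(Rn n, ℂ)} {C : ℂ} {a : Fin n → ℂ} (ha : ∀ j, 0 < (a j).re)
    (hG : ∀ y, G y = C * Complex.exp (-∑ j, a j * (y j : ℂ) ^ 2)) (ζ : Rn n) :
    𝓕 G ζ = C * (∏ j, (Real.pi / a j) ^ (1 / 2 : ℂ)) *
      Complex.exp (-∑ j, Real.pi ^ 2 / a j * (ζ j : ℂ) ^ 2) := by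
  rw [SchwartzMap.fourier_coe, Real.fourier_eq']
  have h (y : Rn n) : Complex.exp (((-2 * Real.pi * ⟪y, ζ⟫_ℝ : ℝ) : ℂ) * Complex.I) • G y =
      C * Complex.exp (-∑ j, a j * (y j : ℂ) ^ 2 +
        ∑ j, (-2 * Real.pi * Complex.I * ζ j) * (y j : ℂ)) := by
    rw [hG, smul_eq_mul, mul_left_comm, ← Complex.exp_add, PiLp.inner_apply]
    congr 2
    rw [add_comm]
    congr 1
    push_cast
    simp only [RCLike.inner_apply, conj_trivial, Finset.mul_sum, Finset.sum_mul]
    refine Finset.sum_congr rfl fun j _ => ?_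
    push_cast
    ring
  simp_rw [h]
  rw [integral_const_mul, integral_cexp_quadratic_euclidean ha, Finset.prod_mul_distrib,
    ← Complex.exp_sum, ← mul_assoc, ← Finset.sum_neg_distrib]
  congr 2
  refine Finset.sum_congr rfl fun j _ => ?_
  have haj : a j ≠ 0 := fun h => by simpa [h] using ha j
  field_simp
  linear_combination (4 * (ζ j : ℂ) ^ 2) * Complex.I_sq

/-- The symbol changes `π²/a` in the exponent to `π²/a + 2π²iħt`; the quotient of the two is `1 +
2iħta`. Taking moduli avoids any choice of branch of the square root. -/
theorem norm_integral_schrodingerSymbol_mul_fourier {ħ : ℝ} (t : ℝ) {G : 𝓢(Rn n, ℂ)}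
    {C : ℂ} {a : Fin n → ℂ} (ha : ∀ j, 0 < (a j).re)
    (hG : ∀ y, G y = C * Complex.exp (-∑ j, a j * (y j : ℂ) ^ 2)) :
    ‖∫ ζ, schrodingerSymbol ħ t ζ * 𝓕 G ζ‖ =
      ‖C‖ * ∏ j, ‖1 + 2 * Complex.I * ħ * t * a j‖ ^ (-(1 / 2) : ℝ) := by
  have haj (j) : a j ≠ 0 := fun h => by simpa [h] using ha j
  have hb (j) : 0 < (Real.pi ^ 2 / a j + 2 * Real.pi ^ 2 * Complex.I * ħ * t : ℂ).re := by
    have h1 : (2 * Real.pi ^ 2 * Complex.I * ħ * t : ℂ) =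
      ((2 * Real.pi ^ 2 * ħ * t : ℝ) : ℂ) * Complex.I := by push_cast; ring
    have h2 : (Real.pi ^ 2 / a j : ℂ) = ((Real.pi ^ 2 : ℝ) : ℂ) * (a j)⁻¹ := by
      push_cast; rw [div_eq_mul_inv]
    rw [h1, h2, Complex.add_re, Complex.re_ofReal_mul, Complex.re_ofReal_mul, Complex.I_re,
      Complex.inv_re, mul_zero, add_zero]
    have := Complex.normSq_pos.mpr (haj j)
    have := ha j
    positivity
  have h (ζ : Rn n) : schrodingerSymbol ħ t ζ * 𝓕 G ζ =
      C * (∏ j, (Real.pi / a j) ^ (1 / 2 : ℂ)) *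
      Complex.exp (-∑ j, (Real.pi ^ 2 / a j + 2 * Real.pi ^ 2 * Complex.I * ħ * t) * (ζ j : ℂ) ^ 2
        + ∑ j, (0 : Fin n → ℂ) j * (ζ j : ℂ)) := by
    rw [fourier_cexp_quadratic ha hG, schrodingerSymbol, mul_left_comm, ← Complex.exp_add,
      EuclideanSpace.real_norm_sq_eq]
    congr 2
    simp only [Pi.zero_apply, zero_mul, Finset.sum_const_zero, add_zero, add_mul,
      Finset.sum_add_distrib, ← Finset.mul_sum]
    push_cast
    ring
  simp_rw [h]
  rw [integral_const_mul, integral_cexp_quadratic_euclidean hb, mul_assoc,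
    ← Finset.prod_mul_distrib, norm_mul, norm_prod]
  congr 1
  refine Finset.prod_congr rfl fun j _ => ?_
  have e : (1 / 2 : ℂ) = ((1 / 2 : ℝ) : ℂ) := by push_cast; rfl
  rw [Pi.zero_apply, zero_pow two_ne_zero, zero_div, Complex.exp_zero, mul_one, norm_mul, e,
    Complex.norm_cpow_real, Complex.norm_cpow_real,
    ← Real.mul_rpow (norm_nonneg _) (norm_nonneg _), ← norm_mul, Real.rpow_neg (norm_nonneg _),
    ← Real.inv_rpow (norm_nonneg _), ← norm_inv]
  congr 2
  have hpi : (Real.pi : ℂ) ≠ 0 := mod_cast Real.pi_ne_zero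
  have hbj : (Real.pi ^ 2 / a j + 2 * Real.pi ^ 2 * Complex.I * ħ * t : ℂ) ≠ 0 := fun h0 => by
    have := hb j
    rw [h0] at this
    simp at this
  have hfac : (Real.pi ^ 2 / a j + 2 * Real.pi ^ 2 * Complex.I * ħ * t : ℂ) =
      Real.pi ^ 2 / a j * (1 + 2 * Complex.I * ħ * t * a j) := by
    have := haj j
    field_simp
  rw [hfac] at hbj ⊢
  have h3 := right_ne_zero_of_mul hbj
  have := haj j
  field_simp

end Gaussian

/-! ### The upper bound for the Gaussian window -/

section UpperBound

open FourierTransform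

variable {n : ℕ}

theorem schrodingerSymbol_neg (ħ t : ℝ) (ζ : Rn n) :
    schrodingerSymbol ħ t (-ζ) = schrodingerSymbol ħ t ζ := by
  rw [schrodingerSymbol, schrodingerSymbol, norm_neg]

theorem fourierMultiplierCLM_schrodingerSymbol_apply_zero (ħ t : ℝ) (G : 𝓢(Rn n, ℂ)) :
    SchwartzMap.fourierMultiplierCLM ℂ (schrodingerSymbol ħ t) G 0 =
      ∫ ζ, schrodingerSymbol ħ t ζ * 𝓕 G ζ := by
  rw [SchwartzMap.fourierMultiplierCLM_apply, SchwartzMap.fourierInv_coe, Real.fourierInv_eq']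
  simp [SchwartzMap.smulLeftCLM_apply_apply (schrodingerSymbol_hasTemperateGrowth ħ t)]

theorem dualPropagator_apply_zero (ħ t : ℝ) (G : 𝓢(Rn n, ℂ)) :
    dualPropagator n ħ t G 0 = ∫ ζ, schrodingerSymbol ħ t ζ * 𝓕 G ζ := by
  change 𝓕 (SchwartzMap.smulLeftCLM ℂ (schrodingerSymbol ħ t) (𝓕⁻ G)) 0 = _
  rw [SchwartzMap.fourier_coe, Real.fourier_eq', ← integral_neg_eq_self]
  congr 1
  funext ζ
  rw [SchwartzMap.smulLeftCLM_apply_apply (schrodingerSymbol_hasTemperateGrowth ħ t),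
    schrodingerSymbol_neg, SchwartzMap.fourierInv_apply_eq]
  simp

theorem gaussianWindow_eq_cexp {ħ : ℝ} (hħ : 0 < ħ) {q : Fin n → ℝ} (hq : ∀ j, 0 < q j)
    (y : Rn n) : gaussianWindow hħ hq y = (((2 * Real.pi * ħ) ^ (-(n : ℝ) / 2) : ℝ) : ℂ) *
      Complex.exp (-∑ j, ((q j / (2 * ħ) : ℝ) : ℂ) * (y j : ℂ) ^ 2) := by
  rw [gaussianWindow_apply, Complex.ofReal_mul, Complex.ofReal_exp]
  congr 2
  push_cast
  rw [neg_mul, Finset.mul_sum]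
  congr 1
  refine Finset.sum_congr rfl fun j _ => ?_
  ring

theorem conj_gaussianWindow {ħ : ℝ} (hħ : 0 < ħ) {q : Fin n → ℝ} (hq : ∀ j, 0 < q j) :
    conj (gaussianWindow hħ hq) = gaussianWindow hħ hq := by
  ext y
  rw [conj_apply, gaussianWindow_apply, Complex.conj_ofReal]

theorem norm_dualPropagator_gaussianWindow {ħ : ℝ} (hħ : 0 < ħ) (t : ℝ) {q : Fin n → ℝ}
    (hq : ∀ j, 0 < q j) :
    ‖dualPropagator n ħ (-t) (gaussianWindow hħ hq) 0‖ =
      (2 * Real.pi * ħ) ^ (-(n : ℝ) / 2) *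
        (∏ j, (t ^ 2 * q j ^ 2 + 1) ^ (1 / 4 : ℝ))⁻¹ := by
  have h0 : 0 ≤ (2 * Real.pi * ħ) ^ (-(n : ℝ) / 2) := by positivity
  rw [dualPropagator_apply_zero, norm_integral_schrodingerSymbol_mul_fourier (-t)
    (a := fun j => ((q j / (2 * ħ) : ℝ) : ℂ)) (fun j => ?_) (gaussianWindow_eq_cexp hħ hq),
    Complex.norm_real, Real.norm_of_nonneg h0, ← Finset.prod_inv_distrib]
  · congr 1
    refine Finset.prod_congr rfl fun j _ => ?_
    -- The factor is `1 - itq_j`, of modulus `(1 + t²q_j²)^{1/2}`; the power `-1/2` yields the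
    -- exponent `-1/4`.
    have h1 : (1 + 2 * Complex.I * ħ * ((-t : ℝ) : ℂ) * ((q j / (2 * ħ) : ℝ) : ℂ)) =
        ((1 : ℝ) : ℂ) + ((-(t * q j) : ℝ) : ℂ) * Complex.I := by
      have : (ħ : ℂ) ≠ 0 := mod_cast hħ.ne'
      push_cast
      field_simp
    rw [h1, Complex.norm_add_mul_I, Real.sqrt_eq_rpow, ← Real.rpow_mul (by positivity),
      ← Real.rpow_neg (by positivity)]
    congr 1
    · ring
    · norm_num
  · have := hq j
    rw [Complex.ofReal_re]
    positivity

theorem lInftyNorm_schrodingerPropagator_le_sjostrandNorm {ħ : ℝ} (hħ : 0 < ħ) (t : ℝ)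
    {q : Fin n → ℝ} (hq : ∀ j, 0 < q j) (f : 𝓢'(Rn n, ℂ)) :
    lInftyNorm (schrodingerPropagator n ħ t f) ≤
      ENNReal.ofReal (∏ j, (t ^ 2 * q j ^ 2 + 1) ^ (1 / 4 : ℝ)) *
        sjostrandNorm ħ (gaussianWindow hħ hq) f := by
  have hC : 0 < (2 * Real.pi * ħ) ^ (-(n : ℝ) / 2) := by positivity
  have hP : 0 < ∏ j, (t ^ 2 * q j ^ 2 + 1) ^ (1 / 4 : ℝ) :=
    Finset.prod_pos fun j _ => by positivity
  have hn := norm_dualPropagator_gaussianWindow hħ t hq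
  have h0 : dualPropagator n ħ (-t) (gaussianWindow hħ hq) 0 ≠ 0 := by
    rw [← norm_pos_iff, hn]
    positivity
  refine (lInftyNorm_schrodingerPropagator_le hħ t (conj_gaussianWindow hħ hq) h0 f).trans_eq ?_
  rw [← ofReal_norm, hn, ← ENNReal.ofReal_inv_of_pos (by positivity), ← mul_assoc,
    ← ENNReal.ofReal_mul (by positivity)]
  congr 2
  field_simp

end UpperBound

/-! ### Chirped Gaussians and their focus -/

section LowerBound

open FourierTransform

variable {n : ℕ}

/-- An `L^∞` representative is unique, and the essential bound holds on a dense set, hence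
everywhere by continuity of `ψ`. -/
theorem enorm_apply_le_lInftyNorm (ψ : 𝓢(Rn n, ℂ)) (x : Rn n) :
    ‖ψ x‖ₑ ≤ lInftyNorm (ψ : 𝓢'(Rn n, ℂ)) := by
  refine le_iInf₂ fun h hh => ?_
  have h1 : h = ψ.toLp ∞ volume := by
    have hk := Lp.ker_toTemperedDistributionCLM_eq_bot (F := ℂ) (μ := (volume : Measure (Rn n)))
      (p := ∞)
    refine LinearMap.ker_eq_bot.mp hk ?_
    change (h : 𝓢'(Rn n, ℂ)) = ((ψ.toLp ∞ volume : Lp ℂ ∞ (volume : Measure (Rn n))) : 𝓢'(Rn n, ℂ))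
    rw [Lp.toTemperedDistribution_toLp_eq, hh]
  have h2 : ‖h‖ₑ = eLpNormEssSup ψ volume := by
    rw [h1, ← eLpNorm_exponent_top]
    exact Lp.enorm_toLp _
  rw [h2]
  have hd := Measure.dense_of_ae (enorm_ae_le_eLpNormEssSup ψ (volume : Measure (Rn n)))
  have hc : IsClosed {y : Rn n | ‖ψ y‖ₑ ≤ eLpNormEssSup ψ volume} :=
    isClosed_le ψ.continuous.enorm continuous_const
  have hx : x ∈ closure {y : Rn n | ‖ψ y‖ₑ ≤ eLpNormEssSup ψ volume} := hd x
  rwa [hc.closure_eq] at hx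

theorem lInftyNorm_zero : lInftyNorm (0 : 𝓢'(Rn n, ℂ)) = 0 := by
  refine le_antisymm ((iInf₂_le 0 ?_).trans_eq (by simp)) zero_le
  exact map_zero (Lp.toTemperedDistributionCLM ℂ (volume : Measure (Rn n)) ∞)

theorem chirp_hasTemperateGrowth (ħ t : ℝ) :
    (fun y : Rn n => Complex.exp (Complex.I * ((-(2 * ħ * t)⁻¹ * ‖y‖ ^ 2 : ℝ) : ℂ)
      )).HasTemperateGrowth :=
  hasTemperateGrowth_cexp_I_comp ((Function.HasTemperateGrowth.const _).mul
    (Function.hasTemperateGrowth_norm_sq (Rn n)))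

/-- The Gaussian of width `ε` with a quadratic phase that focuses at time `t`. -/
def chirpedGaussian (n : ℕ) {ħ ε : ℝ} (hħ : 0 < ħ) (t : ℝ) (hε : 0 < ε) : 𝓢(Rn n, ℂ) :=
  SchwartzMap.smulLeftCLM ℂ
    (fun y : Rn n => Complex.exp (Complex.I * ((-(2 * ħ * t)⁻¹ * ‖y‖ ^ 2 : ℝ) : ℂ)))
    (gaussianWindow hħ (q := fun _ => ε) fun _ => hε)

theorem chirpedGaussian_apply {ħ ε : ℝ} (hħ : 0 < ħ) (t : ℝ) (hε : 0 < ε) (y : Rn n) :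
    chirpedGaussian n hħ t hε y = (((2 * Real.pi * ħ) ^ (-(n : ℝ) / 2) : ℝ) : ℂ) *
      Complex.exp (-∑ j, ((ε + (t : ℂ)⁻¹ * Complex.I) / (2 * ħ)) * (y j : ℂ) ^ 2) := by
  rw [chirpedGaussian, SchwartzMap.smulLeftCLM_apply_apply (chirp_hasTemperateGrowth ħ t),
    gaussianWindow_eq_cexp, smul_eq_mul, mul_left_comm, ← Complex.exp_add,
    EuclideanSpace.real_norm_sq_eq, ← Finset.mul_sum, ← Finset.mul_sum]
  congr 2
  push_cast
  rw [mul_inv]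
  ring

theorem norm_schrodinger_chirpedGaussian {ħ ε t : ℝ} (hħ : 0 < ħ) (ht : t ≠ 0) (hε : 0 < ε) :
    ‖SchwartzMap.fourierMultiplierCLM ℂ (schrodingerSymbol ħ t) (chirpedGaussian n hħ t hε) 0‖ =
      (2 * Real.pi * ħ) ^ (-(n : ℝ) / 2) * ∏ _j : Fin n, (|t| * ε) ^ (-(1 / 2) : ℝ) := by
  have h0 : 0 ≤ (2 * Real.pi * ħ) ^ (-(n : ℝ) / 2) := by positivity
  have hħ' : (ħ : ℂ) ≠ 0 := mod_cast hħ.ne'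
  have ht' : (t : ℂ) ≠ 0 := mod_cast ht
  rw [fourierMultiplierCLM_schrodingerSymbol_apply_zero,
    norm_integral_schrodingerSymbol_mul_fourier t
    (a := fun j => (ε + (t : ℂ)⁻¹ * Complex.I) / (2 * ħ)) (fun j => ?_) (chirpedGaussian_apply hħ t hε),
    Complex.norm_real, Real.norm_of_nonneg h0]
  · congr 1
    refine Finset.prod_congr rfl fun j _ => ?_
    -- The chirp rate is chosen so that its contribution `-1` cancels the `1`; only `itε` survives.
    have h1 : (1 + 2 * Complex.I * ħ * t * ((ε + (t : ℂ)⁻¹ * Complex.I) / (2 * ħ))) =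
        ((t * ε : ℝ) : ℂ) * Complex.I := by
      push_cast
      field_simp
      linear_combination Complex.I_sq
    rw [h1, norm_mul, Complex.norm_I, mul_one, Complex.norm_real, Real.norm_eq_abs, abs_mul,
      abs_of_pos hε]
  · have h1 : ((ε + (t : ℂ)⁻¹ * Complex.I) / (2 * ħ) : ℂ) =
        ((ε / (2 * ħ) : ℝ) : ℂ) + ((t⁻¹ / (2 * ħ) : ℝ) : ℂ) * Complex.I := by
      push_cast
      ring
    rw [h1, Complex.add_re, Complex.re_ofReal_mul, Complex.I_re, Complex.ofReal_re, mul_zero,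
      add_zero]
    positivity

end LowerBound

/-! ### The Sjöstrand norm of a chirped Gaussian -/

section LowerBound

variable {n : ℕ}

/-- With `M = (q + ε)ε + s²`, the right side minus the left is a positive multiple of `(Mx + sξ)²`.
The bound is thus the exact supremum over `x`, attained at `x = -sξ/M`, so nothing is lost in the
norm. -/
theorem re_sq_div_sub_le {q ε s x ξ : ℝ} (hq : 0 < q) (hε : 0 < ε) :
    (((q * x : ℝ) - ξ * Complex.I) ^ 2 / (((q + ε : ℝ) : ℂ) + s * Complex.I) : ℂ).re - q * x ^ 2 ≤
      -(ε / ((q + ε) * ε + s ^ 2)) * ξ ^ 2 := by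
  have hM : 0 < (q + ε) * ε + s ^ 2 := by positivity
  have hD : 0 < (q + ε) ^ 2 + s ^ 2 := by positivity
  have h1 : (((q * x : ℝ) - ξ * Complex.I) ^ 2 / (((q + ε : ℝ) : ℂ) + s * Complex.I) : ℂ).re =
      ((q ^ 2 * x ^ 2 - ξ ^ 2) * (q + ε) - 2 * q * x * ξ * s) / ((q + ε) ^ 2 + s ^ 2) := by
    rw [Complex.div_re]
    have e1 : ((((q * x : ℝ) : ℂ) - ξ * Complex.I) ^ 2).re = q ^ 2 * x ^ 2 - ξ ^ 2 := by
      simp [pow_two]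
      ring
    have e2 : ((((q * x : ℝ) : ℂ) - ξ * Complex.I) ^ 2).im = -2 * q * x * ξ := by
      simp [pow_two]
      ring
    have e3 : (((q + ε : ℝ) : ℂ) + s * Complex.I).re = q + ε := by simp
    have e4 : (((q + ε : ℝ) : ℂ) + s * Complex.I).im = s := by simp
    rw [e1, e2, e3, e4, Complex.normSq_apply, e3, e4]
    ring
  rw [h1, ← sub_nonneg]
  have h2 : -(ε / ((q + ε) * ε + s ^ 2)) * ξ ^ 2 -
      (((q ^ 2 * x ^ 2 - ξ ^ 2) * (q + ε) - 2 * q * x * ξ * s) / ((q + ε) ^ 2 + s ^ 2) - q * x ^ 2)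
      = q * (((q + ε) * ε + s ^ 2) * x + s * ξ) ^ 2 /
        (((q + ε) * ε + s ^ 2) * ((q + ε) ^ 2 + s ^ 2)) := by
    field_simp
    ring
  rw [h2]
  positivity

theorem gabor_chirpedGaussian {ħ ε t : ℝ} (hħ : 0 < ħ) (hε : 0 < ε)
    {q : Fin n → ℝ} (hq : ∀ j, 0 < q j) (x ξ : Rn n) :
    gabor ħ (gaussianWindow hħ hq) (chirpedGaussian n hħ t hε : 𝓢'(Rn n, ℂ)) x ξ =
      (((2 * Real.pi * ħ) ^ (-(n : ℝ) / 2) : ℝ) : ℂ) ^ 3 *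
      ∏ j, ((Real.pi / ((((q j + ε : ℝ) : ℂ) + (t : ℂ)⁻¹ * Complex.I) / (2 * ħ))) ^ (1 / 2 : ℂ) *
        Complex.exp ((((q j * x j : ℝ) - ξ j * Complex.I) ^ 2 /
          (((q j + ε : ℝ) : ℂ) + (t : ℂ)⁻¹ * Complex.I) - (q j * x j ^ 2 : ℝ)) / (2 * ħ))) := by
  have hħ' : (ħ : ℂ) ≠ 0 := mod_cast hħ.ne'
  have hb (j) : 0 < ((((q j + ε : ℝ) : ℂ) + (t : ℂ)⁻¹ * Complex.I) / (2 * ħ) : ℂ).re := by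
    have h1 : ((((q j + ε : ℝ) : ℂ) + (t : ℂ)⁻¹ * Complex.I) / (2 * ħ) : ℂ) =
        (((q j + ε) / (2 * ħ) : ℝ) : ℂ) + ((t⁻¹ / (2 * ħ) : ℝ) : ℂ) * Complex.I := by
      push_cast
      ring
    have := hq j
    rw [h1, Complex.add_re, Complex.re_ofReal_mul, Complex.I_re, Complex.ofReal_re, mul_zero,
      add_zero]
    positivity
  rw [gabor_schwartz]
  have h (y : Rn n) : (starRingEnd ℂ) (modulation ħ ξ y) * (chirpedGaussian n hħ t hε y *
      (starRingEnd ℂ) (gaussianWindow hħ hq (y - x))) =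
      ((((2 * Real.pi * ħ) ^ (-(n : ℝ) / 2) : ℝ) : ℂ) ^ 3 *
        Complex.exp (-∑ j, ((q j * x j ^ 2 : ℝ) : ℂ) / (2 * ħ))) *
      Complex.exp (-∑ j, ((((q j + ε : ℝ) : ℂ) + (t : ℂ)⁻¹ * Complex.I) / (2 * ħ)) * (y j : ℂ) ^ 2
        + ∑ j, (((q j * x j : ℝ) - ξ j * Complex.I) / ħ) * (y j : ℂ)) := by
    rw [← conj_apply (gaussianWindow hħ hq), conj_gaussianWindow, gaussianWindow_eq_cexp,
      chirpedGaussian_apply, modulation, map_mul, Complex.conj_ofReal, ← Complex.exp_conj, map_mul,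
      Complex.conj_I, Complex.conj_ofReal]
    have hassoc (c e₁ e₂ e₃ : ℂ) : c * e₁ * (c * e₂ * (c * e₃)) = c ^ 3 * (e₁ * e₂ * e₃) := by ring
    rw [hassoc, ← Complex.exp_add, ← Complex.exp_add,
      mul_assoc _ (Complex.exp _) (Complex.exp _), ← Complex.exp_add, PiLp.inner_apply]
    congr 2
    push_cast
    simp only [RCLike.inner_apply, conj_trivial, Finset.mul_sum, ← Finset.sum_neg_distrib,
      ← Finset.sum_add_distrib]
    refine Finset.sum_congr rfl fun j _ => ?_
    rw [PiLp.sub_apply]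
    push_cast
    field_simp
    ring
  simp_rw [h]
  rw [integral_const_mul, integral_cexp_quadratic_euclidean hb, mul_assoc, ← Finset.sum_neg_distrib,
    Complex.exp_sum, ← Finset.prod_mul_distrib]
  congr 1
  refine Finset.prod_congr rfl fun j _ => ?_
  rw [mul_left_comm, ← Complex.exp_add]
  congr 2
  have hA : (((q j + ε : ℝ) : ℂ) + (t : ℂ)⁻¹ * Complex.I) ≠ 0 := fun h0 => by
    have := hb j
    rw [h0] at this
    simp at this
  generalize (((q j + ε : ℝ) : ℂ) + (t : ℂ)⁻¹ * Complex.I) = A at hA ⊢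
  field_simp
  ring

theorem norm_gabor_chirpedGaussian_le {ħ ε t : ℝ} (hħ : 0 < ħ) (hε : 0 < ε)
    {q : Fin n → ℝ} (hq : ∀ j, 0 < q j) (x ξ : Rn n) :
    ‖gabor ħ (gaussianWindow hħ hq) (chirpedGaussian n hħ t hε : 𝓢'(Rn n, ℂ)) x ξ‖ ≤
      ((2 * Real.pi * ħ) ^ (-(n : ℝ) / 2)) ^ 3 *
      ∏ j, ((2 * Real.pi * ħ / √((q j + ε) ^ 2 + t⁻¹ ^ 2)) ^ (1 / 2 : ℝ) *
        Real.exp (-(ε / ((q j + ε) * ε + t⁻¹ ^ 2) / (2 * ħ)) * ξ j ^ 2)) := by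
  have h0 : 0 ≤ (2 * Real.pi * ħ) ^ (-(n : ℝ) / 2) := by positivity
  rw [gabor_chirpedGaussian, norm_mul, norm_pow, Complex.norm_real, Real.norm_of_nonneg h0,
    norm_prod]
  gcongr with j
  rw [norm_mul]
  have e : (1 / 2 : ℂ) = ((1 / 2 : ℝ) : ℂ) := by push_cast; rfl
  have e2 : (((q j + ε : ℝ) : ℂ) + (t : ℂ)⁻¹ * Complex.I) =
      ((q j + ε : ℝ) : ℂ) + ((t⁻¹ : ℝ) : ℂ) * Complex.I := by push_cast; rfl
  have e3 : (2 * ħ : ℂ) = ((2 * ħ : ℝ) : ℂ) := by push_cast; rfl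
  rw [e, Complex.norm_cpow_real, e2, e3]
  refine mul_le_mul (le_of_eq ?_) ?_ (norm_nonneg _) (by positivity)
  · rw [norm_div, norm_div, Complex.norm_real, Complex.norm_real, Complex.norm_add_mul_I,
      Real.norm_of_nonneg Real.pi_pos.le, Real.norm_of_nonneg (by positivity)]
    congr 1
    rw [div_div_eq_mul_div]
    ring
  · rw [Complex.norm_exp, Complex.div_ofReal_re, Complex.sub_re, Complex.ofReal_re]
    gcongr
    rw [div_le_iff₀ (by positivity)]
    refine (re_sq_div_sub_le (hq j) hε).trans_eq ?_
    field_simp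

theorem lintegral_prod_gaussian {κ : Fin n → ℝ} (hκ : ∀ j, 0 < κ j) :
    ∫⁻ ξ : Rn n, ENNReal.ofReal (∏ j, Real.exp (-κ j * ξ j ^ 2)) =
      ENNReal.ofReal (∏ j, √(Real.pi / κ j)) := by
  have hm : Measurable fun v : Fin n → ℝ =>
      ENNReal.ofReal (∏ j, Real.exp (-κ j * v j ^ 2)) := by fun_prop
  have h1 : ∫⁻ ξ : Rn n, ENNReal.ofReal (∏ j, Real.exp (-κ j * ξ j ^ 2)) =
      ∫⁻ v : Fin n → ℝ, ENNReal.ofReal (∏ j, Real.exp (-κ j * v j ^ 2)) :=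
    (PiLp.volume_preserving_ofLp (Fin n)).lintegral_comp hm
  have hi : Integrable (fun v : Fin n → ℝ => ∏ j, Real.exp (-κ j * v j ^ 2)) :=
    Integrable.fintype_prod (f := fun j v => Real.exp (-κ j * v ^ 2)) fun j =>
      integrable_exp_neg_mul_sq (hκ j)
  rw [h1, ← ofReal_integral_eq_lintegral_ofReal hi
    (Filter.Eventually.of_forall fun v => Finset.prod_nonneg fun j _ => (Real.exp_pos _).le),
    integral_fintype_prod_volume_eq_prod (f := fun j v => Real.exp (-κ j * v ^ 2))]
  simp_rw [integral_gaussian]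

theorem sjostrandNorm_chirpedGaussian_le {ħ ε t : ℝ} (hħ : 0 < ħ) (hε : 0 < ε)
    {q : Fin n → ℝ} (hq : ∀ j, 0 < q j) :
    sjostrandNorm ħ (gaussianWindow hħ hq) (chirpedGaussian n hħ t hε : 𝓢'(Rn n, ℂ)) ≤
      ENNReal.ofReal ((2 * Real.pi * ħ) ^ (-(n : ℝ) / 2) *
        ∏ j, (((q j + ε) * ε + t⁻¹ ^ 2) / (ε * √((q j + ε) ^ 2 + t⁻¹ ^ 2))) ^ (1 / 2 : ℝ)) := by
  have hp : 0 < 2 * Real.pi * ħ := by positivity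
  have hκ (j) : 0 < ε / ((q j + ε) * ε + t⁻¹ ^ 2) / (2 * ħ) := by
    have := hq j
    positivity
  calc sjostrandNorm ħ (gaussianWindow hħ hq) (chirpedGaussian n hħ t hε : 𝓢'(Rn n, ℂ))
      ≤ ∫⁻ ξ : Rn n, ENNReal.ofReal (((2 * Real.pi * ħ) ^ (-(n : ℝ) / 2)) ^ 3 *
          ∏ j, (2 * Real.pi * ħ / √((q j + ε) ^ 2 + t⁻¹ ^ 2)) ^ (1 / 2 : ℝ)) *
          ENNReal.ofReal (∏ j,
            Real.exp (-(ε / ((q j + ε) * ε + t⁻¹ ^ 2) / (2 * ħ)) * ξ j ^ 2)) := by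
        refine lintegral_mono fun ξ => iSup_le fun x => ?_
        rw [← ofReal_norm, ← ENNReal.ofReal_mul (by positivity), mul_assoc,
          ← Finset.prod_mul_distrib]
        exact ENNReal.ofReal_le_ofReal (norm_gabor_chirpedGaussian_le hħ hε hq x ξ)
    _ = _ := by
        rw [lintegral_const_mul' _ _ ENNReal.ofReal_ne_top, lintegral_prod_gaussian hκ,
          ← ENNReal.ofReal_mul (by positivity), mul_assoc, ← Finset.prod_mul_distrib]
        have h1 (j) : (2 * Real.pi * ħ / √((q j + ε) ^ 2 + t⁻¹ ^ 2)) ^ (1 / 2 : ℝ) *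
            √(Real.pi / (ε / ((q j + ε) * ε + t⁻¹ ^ 2) / (2 * ħ))) = (2 * Real.pi * ħ) *
            (((q j + ε) * ε + t⁻¹ ^ 2) / (ε * √((q j + ε) ^ 2 + t⁻¹ ^ 2))) ^ (1 / 2 : ℝ) := by
          have hqj := hq j
          have hM : 0 < (q j + ε) * ε + t⁻¹ ^ 2 := by positivity
          have hD : 0 < √((q j + ε) ^ 2 + t⁻¹ ^ 2) := by positivity
          have hκj := hκ j
          generalize √((q j + ε) ^ 2 + t⁻¹ ^ 2) = D at hD ⊢
          generalize (q j + ε) * ε + t⁻¹ ^ 2 = M at hM hκj ⊢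
          have e : 2 * Real.pi * ħ = ((2 * Real.pi * ħ) ^ 2) ^ (1 / 2 : ℝ) := by
            rw [← Real.sqrt_eq_rpow, Real.sqrt_sq hp.le]
          rw [Real.sqrt_eq_rpow, ← Real.mul_rpow (by positivity) (by positivity)]
          conv_rhs => rw [e]
          rw [← Real.mul_rpow (by positivity) (by positivity)]
          congr 1
          field_simp
        simp_rw [h1]
        rw [Finset.prod_mul_distrib, Finset.prod_const, Finset.card_univ, Fintype.card_fin,
          ← mul_assoc]
        congr 2
        -- Modulation, chirp and window each give `(2πħ)^{-n/2}`, the two Gaussian integrals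
        -- together `(2πħ)^n`.
        rw [← Real.rpow_natCast _ n, ← Real.rpow_natCast _ 3, ← Real.rpow_mul hp.le,
          ← Real.rpow_add hp]
        congr 1
        push_cast
        ring

end LowerBound

/-! ### The quotient and its limit -/

section LowerBound

open Filter Topology

variable {n : ℕ}

/-- The growth factor of the chirped Gaussian of width `ε` in one coordinate. -/
def chirpRatio (t q ε : ℝ) : ℝ :=
  (√((q + ε) ^ 2 + t⁻¹ ^ 2) / (|t| * ((q + ε) * ε + t⁻¹ ^ 2))) ^ (1 / 2 : ℝ)

/-- The powers of `ε` have already cancelled in the ratio, so it is continuous at `ε = 0` and the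
limit is its value there. -/
theorem tendsto_chirpRatio {t : ℝ} (ht : t ≠ 0) (q : ℝ) :
    Tendsto (chirpRatio t q) (𝓝[>] 0) (𝓝 ((t ^ 2 * q ^ 2 + 1) ^ (1 / 4 : ℝ))) := by
  have h0 : chirpRatio t q 0 = (t ^ 2 * q ^ 2 + 1) ^ (1 / 4 : ℝ) := by
    have ht' : 0 < |t| := abs_pos.mpr ht
    have h1 : √((q + 0) ^ 2 + t⁻¹ ^ 2) / (|t| * ((q + 0) * 0 + t⁻¹ ^ 2)) =
        √(t ^ 2 * q ^ 2 + 1) := by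
      have h2 : t ^ 2 * q ^ 2 + 1 = |t| ^ 2 * ((q + 0) ^ 2 + t⁻¹ ^ 2) := by
        rw [sq_abs]
        field_simp
        ring
      rw [h2, Real.sqrt_mul (by positivity), Real.sqrt_sq ht'.le, ← sq_abs t⁻¹, abs_inv]
      field_simp
      ring
    rw [chirpRatio, h1, Real.sqrt_eq_rpow, ← Real.rpow_mul (by positivity)]
    norm_num
  have hc : ContinuousAt (chirpRatio t q) 0 := by
    refine ContinuousAt.rpow_const (ContinuousAt.div (by fun_prop) (by fun_prop) ?_) (by norm_num)
    have := abs_pos.mpr ht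
    rw [mul_zero, zero_add]
    positivity
  rw [← h0]
  exact hc.tendsto.mono_left nhdsWithin_le_nhds

theorem schrodingerPropagator_coe (ħ t : ℝ) (G : 𝓢(Rn n, ℂ)) :
    schrodingerPropagator n ħ t (G : 𝓢'(Rn n, ℂ)) =
      (SchwartzMap.fourierMultiplierCLM ℂ (schrodingerSymbol ħ t) G : 𝓢'(Rn n, ℂ)) :=
  TemperedDistribution.fourierMultiplierCLM_toTemperedDistributionCLM_eq
    (schrodingerSymbol_hasTemperateGrowth ħ t) G

theorem ofReal_le_lInftyNorm_chirpedGaussian {ħ ε t : ℝ} (hħ : 0 < ħ) (ht : t ≠ 0) (hε : 0 < ε) :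
    ENNReal.ofReal ((2 * Real.pi * ħ) ^ (-(n : ℝ) / 2) *
      ∏ _j : Fin n, (|t| * ε) ^ (-(1 / 2) : ℝ)) ≤
      lInftyNorm (schrodingerPropagator n ħ t (chirpedGaussian n hħ t hε : 𝓢'(Rn n, ℂ))) := by
  rw [schrodingerPropagator_coe, ← norm_schrodinger_chirpedGaussian hħ ht hε, ofReal_norm]
  exact enorm_apply_le_lInftyNorm _ 0

theorem chirpedGaussian_ne_zero {ħ ε t : ℝ} (hħ : 0 < ħ) (ht : t ≠ 0) (hε : 0 < ε) :
    (chirpedGaussian n hħ t hε : 𝓢'(Rn n, ℂ)) ≠ 0 := by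
  intro h0
  have h := ofReal_le_lInftyNorm_chirpedGaussian (n := n) hħ ht hε
  rw [h0, map_zero, lInftyNorm_zero, nonpos_iff_eq_zero, ENNReal.ofReal_eq_zero] at h
  have ht' : 0 < |t| := abs_pos.mpr ht
  have : 0 < (2 * Real.pi * ħ) ^ (-(n : ℝ) / 2) * ∏ _j : Fin n, (|t| * ε) ^ (-(1 / 2) : ℝ) :=
    mul_pos (by positivity) (Finset.prod_pos fun _ _ => by positivity)
  linarith

theorem prod_chirpRatio_le {ħ ε t : ℝ} (hħ : 0 < ħ) (ht : t ≠ 0) (hε : 0 < ε)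
    {q : Fin n → ℝ} (hq : ∀ j, 0 < q j) :
    ENNReal.ofReal (∏ j, chirpRatio t (q j) ε) ≤
      lInftyNorm (schrodingerPropagator n ħ t (chirpedGaussian n hħ t hε : 𝓢'(Rn n, ℂ))) /
        sjostrandNorm ħ (gaussianWindow hħ hq) (chirpedGaussian n hħ t hε : 𝓢'(Rn n, ℂ)) := by
  have ht' : 0 < |t| := abs_pos.mpr ht
  have hB : 0 < (2 * Real.pi * ħ) ^ (-(n : ℝ) / 2) *
        ∏ j, (((q j + ε) * ε + t⁻¹ ^ 2) / (ε * √((q j + ε) ^ 2 + t⁻¹ ^ 2))) ^ (1 / 2 : ℝ) :=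
    mul_pos (by positivity) (Finset.prod_pos fun j _ => by
      have := hq j
      positivity)
  refine le_trans ?_ (ENNReal.div_le_div (ofReal_le_lInftyNorm_chirpedGaussian hħ ht hε)
    (sjostrandNorm_chirpedGaussian_le hħ hε hq))
  rw [← ENNReal.ofReal_div_of_pos hB, mul_div_mul_left _ _ (by positivity),
    ← Finset.prod_div_distrib]
  refine ENNReal.ofReal_le_ofReal (Finset.prod_le_prod (fun j _ => ?_) fun j _ => le_of_eq ?_)
  · exact Real.rpow_nonneg (by have := hq j; positivity) _
  · have hqj := hq j
    have hM : 0 < (q j + ε) * ε + t⁻¹ ^ 2 := by positivity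
    have hD : 0 < √((q j + ε) ^ 2 + t⁻¹ ^ 2) := by positivity
    rw [chirpRatio, Real.rpow_neg (by positivity), ← Real.inv_rpow (by positivity),
      ← Real.div_rpow (by positivity) (by positivity)]
    congr 1
    generalize √((q j + ε) ^ 2 + t⁻¹ ^ 2) = D at hD ⊢
    generalize (q j + ε) * ε + t⁻¹ ^ 2 = M at hM ⊢
    field_simp

theorem chirpedGaussian_mem_sjostrandClass {ħ ε t : ℝ} (hħ : 0 < ħ) (hε : 0 < ε)
    {q : Fin n → ℝ} (hq : ∀ j, 0 < q j) :
    (chirpedGaussian n hħ t hε : 𝓢'(Rn n, ℂ)) ∈ sjostrandClass ħ (gaussianWindow hħ hq) :=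
  (sjostrandNorm_chirpedGaussian_le hħ hε hq).trans_lt ENNReal.ofReal_lt_top

end LowerBound

end Sjostrand

end

/-! ### The sharp constant -/

theorem theorem4p3 (n : ℕ) (ħ t : ℝ) (q : Fin n → ℝ) (hħ : 0 < ħ) (ht : t ≠ 0)
    (hq : ∀ j, 0 < q j) :
    (⨆ f ∈ Sjostrand.sjostrandClass ħ (Sjostrand.gaussianWindow hħ hq) \ {0},
      Sjostrand.lInftyNorm (Sjostrand.schrodingerPropagator n ħ t f) /
        Sjostrand.sjostrandNorm ħ (Sjostrand.gaussianWindow hħ hq) f) =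
      ENNReal.ofReal (∏ j, (t ^ 2 * q j ^ 2 + 1) ^ (1 / 4 : ℝ)) := by
  refine le_antisymm (iSup₂_le fun f _ => ENNReal.div_le_of_le_mul
    (Sjostrand.lInftyNorm_schrodingerPropagator_le_sjostrandNorm hħ t hq f)) ?_
  have hlim : Filter.Tendsto (fun ε => ENNReal.ofReal (∏ j, Sjostrand.chirpRatio t (q j) ε))
      (nhdsWithin 0 (Set.Ioi 0))
      (nhds (ENNReal.ofReal (∏ j, (t ^ 2 * q j ^ 2 + 1) ^ (1 / 4 : ℝ)))) :=
    ENNReal.tendsto_ofReal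
      (tendsto_finsetProd _ fun j _ => Sjostrand.tendsto_chirpRatio ht (q j))
  refine le_of_tendsto hlim ?_
  filter_upwards [self_mem_nhdsWithin] with ε hε
  exact (Sjostrand.prod_chirpRatio_le hħ ht hε hq).trans
    (le_iSup₂_of_le (Sjostrand.chirpedGaussian n hħ t hε : 𝓢'(Sjostrand.Rn n, ℂ))
      ⟨Sjostrand.chirpedGaussian_mem_sjostrandClass hħ hε hq,
        Sjostrand.chirpedGaussian_ne_zero hħ ht hε⟩ le_rfl)
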